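/- Let $m,n\ge 0$ be integers with $m\neq n$. Put $\bar i=0$ for $1\le i\le m$ and $\bar i=1$ for $m<i\le m+n$; let $e_{ij}$ be the matrix units of $\mathrm{End}\,\mathbb{C}^{m|n}$ (of parity $\bar i+\bar j$), $P=\sum_{i,j}e_{ij}\otimes e_{ji}(-1)^{\bar j}$, $R(u)=1-Pu^{-1}$, let $g(u)\in 1+u^{-1}\mathbb{C}[[u^{-1}]]$ be the unique series with $g(u+m-n)=(1-u^{-2})g(u)$, and put $\overline R(u)=g(u)R(u)$. All tensor products are $\mathbb{Z}_2$-graded. The double Yangian $\mathrm{DY}(\mathfrak{gl}_{m|n})$ is the unital associative $\mathbb{C}$-superalgebra generated by an even central element $C$ and elements $t_{ij}^{(r)},t_{ij}^{(-r)}$ of parity $\bar i+\bar j$ ($1\le i,j\le m+n$, $r\ge1$), subject to $$R(u-v)T_1(u)T_2(v)=T_2(v)T_1(u)R(u-v),\qquad R(u-v)T^+_1(u)T^+_2(v)=T^+_2(v)T^+_1(u)R(u-v),$$ $$\overline R(u-v+C/2)\,T_1(u)\,T_2^+(v)=T_2^+(v)\,T_1(u)\,\overline R(u-v-C/2)$$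 (in the last relation $\overline R$ is expanded in nonnegative powers of $u^{-1}$ and $v$), where $T(u)=\sum_{i,j}(-1)^{\bar i\bar j+\bar j}e_{ij}\otimes t_{ij}(u)$, $T^+(u)=\sum_{i,j}(-1)^{\bar i\bar j+\bar j}e_{ij}\otimes t^+_{ij}(u)$, $t_{ij}(u)=\delta_{ij}+\sum_{r\ge1}t_{ij}^{(r)}u^{-r}$ and $t^+_{ij}(u)=\delta_{ij}-\sum_{r\ge1}t_{ij}^{(-r)}u^{r-1}$. Give $\mathrm{DY}(\mathfrak{gl}_{m|n})$ the topology of the ascending filtration with $\deg t_{ij}^{(r)}=r-1$, $\deg t_{ij}^{(-r)}=-r$, $\deg C=0$. Let $\mathrm{Y}$ (resp. $\mathrm{Y}^+$) be the unital subalgebra generated by all $t_{ij}^{(r)}$ (resp. all $t_{ij}^{(-r)}$), and let $\widetilde{\mathrm{Y}}^+$ be the completion of $\mathrm{Y}^+$ with respect to the descending filtration in which $t_{ij}^{(-r)}$ has degree $r$. The extended double Yangian $\widetilde{\mathrm{DY}}(\mathfrak{gl}_{m|n})$ is the algebra of all finite $\mathbb{C}[C]$-linear combinations of products $xy$, $x\in\widetilde{\mathrm{Y}}^+$,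 $y\in\mathrm{Y}$, with the multiplication extended by continuity, inside the completion of $\mathrm{DY}(\mathfrak{gl}_{m|n})$. Let $\tau\colon e_{ij}\mapsto(-1)^{\bar i\bar j+\bar i}e_{ji}$, and let $\tau_2$ be $\tau$ applied to the second tensor factor. **Theorem.** There exist unique series $z(u)=\sum_{N\ge0}z_Nu^{-N}$ and $z^+(u)=\sum_{N\ge0}z^+_Nu^N$ (the quantum contraction and its dual analogue) such that $$P^{\tau_2}\,T_1(u+m-n)\,\bigl(T_2(u)^{-1}\bigr)^{\tau}=P^{\tau_2}\otimes z(u),\qquad P^{\tau_2}\,T^+_1(u+m-n)\,\bigl(T^+_2(u)^{-1}\bigr)^{\tau}=P^{\tau_2}\otimes z^+(u),$$ where $z_N\in\mathrm{Y}$ and $z^+_N\in\widetilde{\mathrm{Y}}^+$ for all $N$, and all coefficients $z_N$ and $z^+_N$ belong to the centre of the extended double Yangian $\widetilde{\mathrm{DY}}(\mathfrak{gl}_{m|n})$. -/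

import Mathlib

open Filter Topology

noncomputable section

namespace DoubleYangian

/-! ### Formal shifts and the normalizing series -/

/-- Coefficients of `f(u + c)` in powers of `u⁻¹`, where `f(u) = ∑ r, f r u⁻ʳ`, obtained from
`(u + c)⁻ʳ = ∑ k, binom(-r, k) cᵏ u⁻ʳ⁻ᵏ`. -/
def shiftSeries {B : Type*} [Ring B] (c : B) (f : ℕ → B) (N : ℕ) : B :=
  ∑ r ∈ Finset.range (N + 1), Ring.choose (-(r : ℤ)) (N - r) • (f r * c ^ (N - r))

/-- Coefficients of the series `g(u) = 1 + g₁ u⁻¹ + g₂ u⁻² + ⋯`; for `k ≠ 0` it is the unique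
series with constant term `1` such that `g(u + k) = (1 - u⁻²) g(u)`
(see `gCoef_functional` and `gCoef_unique`). -/
def gCoef (k : ℂ) : ℕ → ℂ
  | 0 => 1
  | M + 1 => (((M : ℂ) + 1) * k)⁻¹ * (gCoef k M + ∑ r : Fin (M + 1),
      (Ring.choose (-((r : ℕ) : ℤ)) (M + 2 - r) : ℤ) • (gCoef k r * k ^ (M + 2 - (r : ℕ))))
termination_by N => N
decreasing_by
  all_goals omega

theorem shiftSeries_step (k : ℂ) (f : ℕ → ℂ) (M : ℕ) :
    shiftSeries k f (M + 2) = f (M + 2) - ((M : ℂ) + 1) * k * f (M + 1)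
      + ∑ r : Fin (M + 1),
        (Ring.choose (-((r : ℕ) : ℤ)) (M + 2 - r) : ℤ) • (f r * k ^ (M + 2 - (r : ℕ))) := by
  have h1 : M + 1 + 1 - (M + 1) = 1 := by omega
  rw [shiftSeries, Finset.sum_range_succ, Finset.sum_range_succ, Finset.sum_range]
  simp only [Nat.sub_self, Ring.choose_zero_right, pow_zero, mul_one, one_smul, h1,
    Ring.choose_one_right, pow_one, zsmul_eq_mul]
  push_cast
  ring

theorem gCoef_functional (k : ℂ) (hk : k ≠ 0) :
    PowerSeries.mk (shiftSeries k (gCoef k)) = (1 - PowerSeries.X ^ 2) * PowerSeries.mk (gCoef k) := by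
  ext N
  rw [sub_mul, one_mul, map_sub, PowerSeries.coeff_mk, PowerSeries.coeff_mk]
  match N with
  | 0 => simp [shiftSeries, PowerSeries.coeff_X_pow_mul']
  | 1 =>
    simp [shiftSeries, PowerSeries.coeff_X_pow_mul', Finset.sum_range_succ]
  | M + 2 =>
    rw [shiftSeries_step, PowerSeries.coeff_X_pow_mul, PowerSeries.coeff_mk]
    have hM : ((M : ℂ) + 1) ≠ 0 := by exact_mod_cast Nat.succ_ne_zero M
    have : ((M : ℂ) + 1) * k * gCoef k (M + 1) = gCoef k M + ∑ r : Fin (M + 1),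
      (Ring.choose (-((r : ℕ) : ℤ)) (M + 2 - r) : ℤ) • (gCoef k r * k ^ (M + 2 - (r : ℕ))) := by
      rw [gCoef, ← mul_assoc, mul_inv_cancel₀ (mul_ne_zero hM hk), one_mul]
    rw [this]
    ring

theorem gCoef_unique (k : ℂ) (hk : k ≠ 0) (f : ℕ → ℂ) (h0 : f 0 = 1)
    (hf : PowerSeries.mk (shiftSeries k f) = (1 - PowerSeries.X ^ 2) * PowerSeries.mk f) :
    f = gCoef k := by
  funext N
  induction N using Nat.strong_induction_on with
  | _ N ih =>
    match N with
    | 0 => rw [h0, gCoef]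
    | M + 1 =>
      have h := congrArg (PowerSeries.coeff (M + 2)) hf
      rw [sub_mul, one_mul, map_sub, PowerSeries.coeff_mk, PowerSeries.coeff_mk, shiftSeries_step,
        PowerSeries.coeff_X_pow_mul, PowerSeries.coeff_mk] at h
      have hM : ((M : ℂ) + 1) ≠ 0 := by exact_mod_cast Nat.succ_ne_zero M
      have e : ∑ r : Fin (M + 1), (Ring.choose (-((r : ℕ) : ℤ)) (M + 2 - r) : ℤ) •
            (f r * k ^ (M + 2 - (r : ℕ)))
          = ∑ r : Fin (M + 1), (Ring.choose (-((r : ℕ) : ℤ)) (M + 2 - r) : ℤ) •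
            (gCoef k r * k ^ (M + 2 - (r : ℕ))) :=
        Finset.sum_congr rfl fun r _ => by rw [ih r r.2]
      rw [gCoef, ← e, ← ih M (Nat.lt_succ_self M)]
      rw [eq_inv_mul_iff_mul_eq₀ (mul_ne_zero hM hk)]
      linear_combination -h

/-! ### Even elements of `End ℂ^{m|n} ⊗ A` and `End ℂ^{m|n} ⊗ End ℂ^{m|n} ⊗ A`

All tensor products are graded. The indices `1, …, m` are `Sum.inl`, and `m+1, …, m+n`
are `Sum.inr`. An even element of `End V ⊗ A` is `∑ e_ij ⊗ x_ij` with `x_ij` of parity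
`|i| + |j|`, and an even element of `End V ⊗ End V ⊗ A` is `∑ e_ij ⊗ e_kl ⊗ x_ijkl` with
`x_ijkl` of parity `|i| + |j| + |k| + |l|`. They are multiplied through their action on `V ⊗ A`
and `V ⊗ V ⊗ A`, that is, as ordinary matrices over `A`; `evenOp₂_mul` is the Koszul rule. -/

/-- Index set of the standard basis of `ℂ^{m|n}`. -/
abbrev Idx (m n : ℕ) : Type := Fin m ⊕ Fin n

/-- Parity of a basis index. -/
def par {m n : ℕ} : Idx m n → ℕ
  | Sum.inl _ => 0
  | Sum.inr _ => 1

section Tensors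

variable {m n : ℕ} {A : Type*} [Ring A]

/-- The matrix of `∑ e_ij ⊗ x_ij` (even), acting by
`(e_ij ⊗ x)(v_j ⊗ b) = (-1)^{|x||j|} v_i ⊗ x b`, `|x| = |i| + |j|`. -/
def evenOp (x : Idx m n → Idx m n → A) : Matrix (Idx m n) (Idx m n) A :=
  fun i j => (-1) ^ ((par i + par j) * par j) * x i j

/-- The coefficients `x_ij` of the even element `∑ e_ij ⊗ x_ij` with matrix `M`. -/
def evenCoef (M : Matrix (Idx m n) (Idx m n) A) : Idx m n → Idx m n → A :=
  fun i j => (-1) ^ ((par i + par j) * par j) * M i j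

theorem evenOp_evenCoef (M : Matrix (Idx m n) (Idx m n) A) : evenOp (evenCoef M) = M := by
  ext i j
  simp only [evenOp, evenCoef, ← mul_assoc, ← pow_add]
  rw [Even.neg_one_pow ⟨_, rfl⟩, one_mul]

/-- The matrix of `∑ e_ij ⊗ e_kl ⊗ x_ijkl` (even), acting by
`(e_ij ⊗ e_kl ⊗ x)(v_j ⊗ v_l ⊗ b) = (-1)^{(|k|+|l|)|j| + |x|(|j|+|l|)} v_i ⊗ v_k ⊗ x b`,
`|x| = |i| + |j| + |k| + |l|`; the row index is `(i, k)`, the column index is `(j, l)`. -/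
def evenOp₂ (x : Idx m n → Idx m n → Idx m n → Idx m n → A) :
    Matrix (Idx m n × Idx m n) (Idx m n × Idx m n) A :=
  fun a b => (-1) ^ ((par a.2 + par b.2) * par b.1 +
    (par a.1 + par b.1 + par a.2 + par b.2) * (par b.1 + par b.2)) * x a.1 b.1 a.2 b.2

/-- The matrix product is the product of the graded tensor product, in which
`(e_ip ⊗ e_kq ⊗ x)(e_pj ⊗ e_ql ⊗ y)` is
`(-1)^{|x|(|p|+|j|+|q|+|l|) + (|k|+|q|)(|p|+|j|)} e_ij ⊗ e_kl ⊗ x y`. -/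
theorem evenOp₂_mul (x y : Idx m n → Idx m n → Idx m n → Idx m n → A) :
    evenOp₂ x * evenOp₂ y = evenOp₂ fun i j k l => ∑ p, ∑ q,
      (-1) ^ ((par i + par p + par k + par q) * (par p + par j + par q + par l) +
        (par k + par q) * (par p + par j)) * (x i p k q * y p j q l) := by
  have hs : ∀ (s t : ℕ) (a b : A), (-1) ^ s * a * ((-1) ^ t * b) = (-1) ^ (s + t) * (a * b) := by
    intro s t a b
    rw [pow_add, mul_assoc, mul_assoc, ← mul_assoc a, ← (((Commute.neg_one_left a).pow_left t).eq),
      mul_assoc]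
  ext ⟨i, k⟩ ⟨j, l⟩
  simp only [Matrix.mul_apply, evenOp₂, Fintype.sum_prod_type, Finset.mul_sum]
  refine Finset.sum_congr rfl fun p _ => Finset.sum_congr rfl fun q _ => ?_
  rw [hs, ← mul_assoc ((-1) ^ _) ((-1) ^ _), ← pow_add]
  congr 1
  rw [neg_one_pow_eq_pow_mod_two, neg_one_pow_eq_pow_mod_two (n := _ + _)]
  congr 1
  cases i <;> cases j <;> cases k <;> cases l <;> cases p <;> cases q <;> simp [par]

/-- `X ↦ X₁`: coefficients of `∑ e_ij ⊗ 1 ⊗ x_ij`. -/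
def leg₁ (x : Idx m n → Idx m n → A) : Idx m n → Idx m n → Idx m n → Idx m n → A :=
  fun i j k l => if k = l then x i j else 0

/-- `X ↦ X₂`: coefficients of `∑ 1 ⊗ e_kl ⊗ x_kl`. -/
def leg₂ (x : Idx m n → Idx m n → A) : Idx m n → Idx m n → Idx m n → Idx m n → A :=
  fun i j k l => if i = j then x k l else 0

/-- The transposition `τ : e_ij ↦ (-1)^{|i||j| + |i|} e_ji`. -/
def transp (x : Idx m n → Idx m n → A) : Idx m n → Idx m n → A :=
  fun i j => (-1) ^ (par j * par i + par j) * x j i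

/-- The transposition `τ₂` in the second tensor factor. -/
def transp₂ (x : Idx m n → Idx m n → Idx m n → Idx m n → A) :
    Idx m n → Idx m n → Idx m n → Idx m n → A :=
  fun i j k l => (-1) ^ (par l * par k + par l) * x i j l k

/-- `P = ∑ e_ij ⊗ e_ji (-1)^{|j|}`. -/
def permP : Idx m n → Idx m n → Idx m n → Idx m n → A :=
  fun i j k l => if k = j ∧ l = i then (-1) ^ par j else 0

/-- The coefficient of `u⁻ᴺ` in `T(u) = ∑ (-1)^{|i||j|+|j|} e_ij ⊗ t_ij(u)`,
`t_ij(u) = δ_ij + ∑_{r ≥ 1} t_ij^{(r)} u⁻ʳ`. Here `t i j r` stands for `t_ij^{(r+1)}`. -/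
def tCoef (t : Idx m n → Idx m n → ℕ → A) : ℕ → Idx m n → Idx m n → A
  | 0, i, j => (-1) ^ (par i * par j + par j) * (if i = j then 1 else 0)
  | r + 1, i, j => (-1) ^ (par i * par j + par j) * t i j r

/-- The coefficient of `uᴺ` in `T⁺(u) = ∑ (-1)^{|i||j|+|j|} e_ij ⊗ t⁺_ij(u)`,
`t⁺_ij(u) = δ_ij - ∑_{r ≥ 1} t_ij^{(-r)} uʳ⁻¹`. Here `s i j r` stands for `t_ij^{(-r-1)}`. -/
def tPlusCoef (s : Idx m n → Idx m n → ℕ → A) (N : ℕ) (i j : Idx m n) : A :=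
  (-1) ^ (par i * par j + par j) * ((if N = 0 ∧ i = j then 1 else 0) - s i j N)

end Tensors

/-! ### The double Yangian -/

/-- Generators: `C`, `t i j r = t_ij^{(r+1)}` and `s i j r = t_ij^{(-r-1)}`, `r = 0, 1, 2, …`. -/
inductive Gen (m n : ℕ) : Type
  | C : Gen m n
  | t (i j : Idx m n) (r : ℕ) : Gen m n
  | s (i j : Idx m n) (r : ℕ) : Gen m n

section Relations

variable (m n : ℕ)

/-- Formal power series in two commuting variables (the outer and the inner one) with
coefficients in the endomorphisms of `V ⊗ V ⊗ F`, where `F` is the free algebra. -/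
abbrev BiSeries : Type :=
  PowerSeries (PowerSeries
    (Matrix (Idx m n × Idx m n) (Idx m n × Idx m n) (FreeAlgebra ℂ (Gen m n))))

variable {m n} in
/-- `∑ f_r x^r`, where `x` is the outer variable. -/
def outer (f : ℕ → Matrix (Idx m n × Idx m n) (Idx m n × Idx m n) (FreeAlgebra ℂ (Gen m n))) :
    BiSeries m n := PowerSeries.mk fun r => PowerSeries.C (f r)

variable {m n} in
/-- `∑ f_r y^r`, where `y` is the inner variable. -/
def inner (f : ℕ → Matrix (Idx m n × Idx m n) (Idx m n × Idx m n) (FreeAlgebra ℂ (Gen m n))) :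
    BiSeries m n := PowerSeries.C (PowerSeries.mk f)

/-- The outer variable. -/
def xv : BiSeries m n := PowerSeries.X

/-- The inner variable. -/
def yv : BiSeries m n := PowerSeries.C PowerSeries.X

/-- `P` as a constant series. -/
def Pc : BiSeries m n := PowerSeries.C (PowerSeries.C (evenOp₂ permP))

/-- Coefficients of the generator matrix `T` over the free algebra. -/
def freeT : ℕ → Idx m n → Idx m n → FreeAlgebra ℂ (Gen m n) :=
  tCoef fun i j r => FreeAlgebra.ι ℂ (Gen.t i j r)

/-- Coefficients of the generator matrix `T⁺` over the free algebra. -/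
def freeTPlus : ℕ → Idx m n → Idx m n → FreeAlgebra ℂ (Gen m n) :=
  tPlusCoef fun i j r => FreeAlgebra.ι ℂ (Gen.s i j r)

/-- The coefficient of `u⁻ʳ` in `R̄(u) = g(u) (1 - P u⁻¹)`, with `g(u + m - n) = (1 - u⁻²) g(u)`. -/
def rBarCoef : ℕ → Matrix (Idx m n × Idx m n) (Idx m n × Idx m n) (FreeAlgebra ℂ (Gen m n))
  | 0 => gCoef ((m : ℂ) - n) 0 • 1
  | r + 1 => gCoef ((m : ℂ) - n) (r + 1) • 1 - gCoef ((m : ℂ) - n) r • evenOp₂ permP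

/-- `R̄(u - v + εC)`, expanded in nonnegative powers of `u⁻¹` (outer variable)
and `v` (inner variable). -/
def rBar (ε : ℂ) : BiSeries m n :=
  PowerSeries.mk <| shiftSeries
    (-PowerSeries.X + PowerSeries.C (ε • Matrix.scalar _ (FreeAlgebra.ι ℂ Gen.C)))
    (fun r => PowerSeries.C (rBarCoef m n r))

/-- The defining relations of the double Yangian, coefficient by coefficient and matrix entry by
matrix entry. -/
inductive Rel : FreeAlgebra ℂ (Gen m n) → FreeAlgebra ℂ (Gen m n) → Prop
  /-- `C` is central. -/
  | central (a : Gen m n) :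
      Rel (FreeAlgebra.ι ℂ Gen.C * FreeAlgebra.ι ℂ a) (FreeAlgebra.ι ℂ a * FreeAlgebra.ι ℂ Gen.C)
  /-- `R(u-v) T₁(u) T₂(v) = T₂(v) T₁(u) R(u-v)`, multiplied by `(u - v) u⁻¹ v⁻¹`,
  with `x = u⁻¹` and `y = v⁻¹`. -/
  | rtt (a b : ℕ) (p q : Idx m n × Idx m n) :
      Rel
        (PowerSeries.coeff b (PowerSeries.coeff a
          ((yv m n - xv m n - xv m n * yv m n * Pc m n) *
            outer (fun r => evenOp₂ (leg₁ (freeT m n r))) *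
            inner (fun r => evenOp₂ (leg₂ (freeT m n r))))) p q)
        (PowerSeries.coeff b (PowerSeries.coeff a
          (inner (fun r => evenOp₂ (leg₂ (freeT m n r))) *
            outer (fun r => evenOp₂ (leg₁ (freeT m n r))) *
            (yv m n - xv m n - xv m n * yv m n * Pc m n))) p q)
  /-- `R(u-v) T₁⁺(u) T₂⁺(v) = T₂⁺(v) T₁⁺(u) R(u-v)`, multiplied by `u - v`,
  with `x = u` and `y = v`. -/
  | rttPlus (a b : ℕ) (p q : Idx m n × Idx m n) :
      Rel
        (PowerSeries.coeff b (PowerSeries.coeff a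
          ((xv m n - yv m n - Pc m n) *
            outer (fun r => evenOp₂ (leg₁ (freeTPlus m n r))) *
            inner (fun r => evenOp₂ (leg₂ (freeTPlus m n r))))) p q)
        (PowerSeries.coeff b (PowerSeries.coeff a
          (inner (fun r => evenOp₂ (leg₂ (freeTPlus m n r))) *
            outer (fun r => evenOp₂ (leg₁ (freeTPlus m n r))) *
            (xv m n - yv m n - Pc m n))) p q)
  /-- `R̄(u-v+C/2) T₁(u) T₂⁺(v) = T₂⁺(v) T₁(u) R̄(u-v-C/2)`, with `x = u⁻¹` and `y = v`. -/
  | rttMixed (a b : ℕ) (p q : Idx m n × Idx m n) :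
      Rel
        (PowerSeries.coeff b (PowerSeries.coeff a
          (rBar m n (1 / 2) *
            outer (fun r => evenOp₂ (leg₁ (freeT m n r))) *
            inner (fun r => evenOp₂ (leg₂ (freeTPlus m n r))))) p q)
        (PowerSeries.coeff b (PowerSeries.coeff a
          (inner (fun r => evenOp₂ (leg₂ (freeTPlus m n r))) *
            outer (fun r => evenOp₂ (leg₁ (freeT m n r))) *
            rBar m n (-(1 / 2)))) p q)

/-- The double Yangian `DY(gl_{m|n})`. -/
def DY : Type := RingQuot (Rel m n)

instance : Ring (DY m n) := inferInstanceAs (Ring (RingQuot (Rel m n)))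

instance : Algebra ℂ (DY m n) := inferInstanceAs (Algebra ℂ (RingQuot (Rel m n)))

variable {m n} in
/-- The images of the generators in the double Yangian. -/
def gen (a : Gen m n) : DY m n := RingQuot.mkAlgHom ℂ (Rel m n) (FreeAlgebra.ι ℂ a)

/-! ### The topology of the double Yangian and the extended double Yangian -/

variable {m n} in
/-- `deg t_ij^{(r)} = r - 1`, `deg t_ij^{(-r)} = -r`, `deg C = 0`. -/
def Gen.deg : Gen m n → ℤ
  | Gen.C => 0
  | Gen.t _ _ r => r
  | Gen.s _ _ r => -((r : ℤ) + 1)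

/-- The ascending filtration: the span of all monomials of degree at most `d`. -/
def fil (d : ℤ) : Submodule ℂ (DY m n) :=
  Submodule.span ℂ {x | ∃ l : List (Gen m n), (l.map Gen.deg).sum ≤ d ∧ x = (l.map gen).prod}

variable {m n}

theorem fil_mono {d e : ℤ} (h : d ≤ e) : fil m n d ≤ fil m n e :=
  Submodule.span_mono fun _ ⟨l, hl, hx⟩ => ⟨l, hl.trans h, hx⟩

theorem mul_mem_fil {d e : ℤ} {x y : DY m n} (hx : x ∈ fil m n d) (hy : y ∈ fil m n e) :
    x * y ∈ fil m n (d + e) := by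
  have h : fil m n d * fil m n e ≤ fil m n (d + e) := by
    rw [fil, fil, Submodule.span_mul_span]
    refine Submodule.span_mono ?_
    rintro _ ⟨_, ⟨l, hl, rfl⟩, _, ⟨l', hl', rfl⟩, rfl⟩
    exact ⟨l ++ l', by simpa using add_le_add hl hl', by simp⟩
  exact h (Submodule.mul_mem_mul hx hy)

theorem exists_mem_fil (x : DY m n) : ∃ d : ℕ, x ∈ fil m n d := by
  obtain ⟨a, rfl⟩ := RingQuot.mkAlgHom_surjective ℂ (Rel m n) x
  induction a using FreeAlgebra.induction with
  | grade0 r =>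
    refine ⟨0, ?_⟩
    rw [AlgHom.commutes, Algebra.algebraMap_eq_smul_one]
    exact Submodule.smul_mem _ _ (Submodule.subset_span ⟨[], by simp, by simp; rfl⟩)
  | grade1 a =>
    exact ⟨(Gen.deg a).toNat, Submodule.subset_span
      ⟨[a], by simp, (List.prod_singleton (x := gen a)).symm⟩⟩
  | mul a b ha hb =>
    obtain ⟨d, hd⟩ := ha
    obtain ⟨e, he⟩ := hb
    refine ⟨d + e, ?_⟩
    rw [map_mul]
    exact_mod_cast mul_mem_fil hd he
  | add a b ha hb =>
    obtain ⟨d, hd⟩ := ha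
    obtain ⟨e, he⟩ := hb
    refine ⟨d + e, ?_⟩
    rw [map_add]
    exact Submodule.add_mem _ (fil_mono (by simp) hd) (fil_mono (by simp) he)

variable (m n)

/-- The subspaces of elements of degree at most `-p`. -/
def nbhd (p : ℕ) : AddSubgroup (DY m n) := (fil m n (-(p : ℤ))).toAddSubgroup

theorem nbhd_basis : RingSubgroupsBasis (nbhd m n) where
  inter p q := ⟨max p q, fun _ hx => ⟨fil_mono (by simp) hx, fil_mono (by simp) hx⟩⟩
  mul p := ⟨p, by
    rintro _ ⟨x, hx, y, hy, rfl⟩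
    exact fil_mono (by simp) (mul_mem_fil hx hy)⟩
  leftMul x p := by
    obtain ⟨d, hd⟩ := exists_mem_fil x
    refine ⟨p + d, fun y hy => ?_⟩
    exact fil_mono (by push_cast; omega) (mul_mem_fil hd hy)
  rightMul x p := by
    obtain ⟨d, hd⟩ := exists_mem_fil x
    refine ⟨p + d, fun y hy => ?_⟩
    exact fil_mono (by push_cast; omega) (mul_mem_fil hy hd)

/-- The topology of `DY(gl_{m|n})` induced by the filtration: the subspaces of elements of degree
at most `-p`, `p = 0, 1, 2, …`, form a basis of neighbourhoods of zero. -/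
abbrev dyTopology : TopologicalSpace (DY m n) := (nbhd_basis m n).topology

theorem dyTopology_ring : @IsTopologicalRing (DY m n) (dyTopology m n) _ :=
  (nbhd_basis m n).toRingFilterBasis.isTopologicalRing

/-- The additive uniform structure of that topology. -/
instance : UniformSpace (DY m n) :=
  letI := dyTopology m n
  haveI := dyTopology_ring m n
  IsTopologicalAddGroup.rightUniformSpace (DY m n)

instance : IsTopologicalRing (DY m n) := dyTopology_ring m n

instance : IsUniformAddGroup (DY m n) :=
  letI := dyTopology m n
  haveI := dyTopology_ring m n
  isUniformAddGroup_of_addCommGroup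

instance : UniformContinuousConstSMul ℂ (DY m n) where
  uniformContinuous_const_smul c := by
    refine uniformContinuous_addMonoidHom_of_continuous
      (f := DistribSMul.toAddMonoidHom (DY m n) c) ?_
    have h : Continuous fun x : DY m n => algebraMap ℂ (DY m n) c * x := continuous_const_mul _
    simp only [← Algebra.smul_def] at h
    exact h

/-- The completion of the double Yangian with respect to the topology above; its multiplication
is the continuous extension of that of the double Yangian. -/
abbrev Comp : Type := UniformSpace.Completion (DY m n)

variable {m n} in
/-- The images of the generators in the completion. -/
def cgen (a : Gen m n) : Comp m n := ((gen a : DY m n) : Comp m n)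

/-- The Yangian, i.e. the subalgebra generated by all `t_ij^{(r)}`, `r ≥ 1`. -/
def Yangian : Subalgebra ℂ (Comp m n) :=
  Algebra.adjoin ℂ {x | ∃ i j r, x = cgen (Gen.t i j r)}

/-- The dual Yangian, i.e. the subalgebra of the double Yangian generated by all `t_ij^{(-r)}`,
`r ≥ 1`. -/
def DualYangian : Subalgebra ℂ (DY m n) :=
  Algebra.adjoin ℂ {x | ∃ i j r, x = gen (Gen.s i j r)}

/-- The descending filtration of the dual Yangian: the span of all monomials
`t_{i₁j₁}^{(-r₁)} ⋯ t_{iₖjₖ}^{(-rₖ)}` with `r₁ + ⋯ + rₖ ≥ p`. -/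
def dualFil (p : ℕ) : Submodule ℂ (DY m n) :=
  Submodule.span ℂ {x | ∃ l : List (Idx m n × Idx m n × ℕ),
    p ≤ (l.map fun a => a.2.2 + 1).sum ∧ x = (l.map fun a => gen (Gen.s a.1 a.2.1 a.2.2)).prod}

/-- The extended dual Yangian, i.e. the completion of the dual Yangian with respect to its
descending filtration, inside the completion of the double Yangian: the limits of all sequences
`y₀, y₁, …` in the dual Yangian such that `y_{p+1} - y_p` is of degree at least `p`. -/
def ExtDualYangian : Set (Comp m n) :=
  {x | ∃ y : ℕ → DY m n, (∀ p, y p ∈ DualYangian m n) ∧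
    (∀ p, y (p + 1) - y p ∈ dualFil m n p) ∧
    Tendsto (fun p => (y p : Comp m n)) atTop (𝓝 x)}

/-- All finite `ℂ[C]`-linear combinations of products `x y` with `x` in the extended dual Yangian
and `y` in the Yangian. -/
def extSpan : Submodule ℂ (Comp m n) :=
  Submodule.span ℂ {w | ∃ k : ℕ, ∃ x ∈ ExtDualYangian m n, ∃ y ∈ Yangian m n,
    w = cgen Gen.C ^ k * x * y}

/-- The extended double Yangian: `extSpan` with the multiplication of the completion. Moving the
generators `t_ij^{(r)}` to the right shows that `extSpan` is closed under this multiplication, so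
that it coincides with the subalgebra it generates. -/
def ExtDY : Subalgebra ℂ (Comp m n) := Algebra.adjoin ℂ (extSpan m n : Set (Comp m n))

/-! ### Quantum contractions -/

/-- Coefficients of `T(u)` in powers of `u⁻¹`. -/
def T : ℕ → Idx m n → Idx m n → Comp m n := tCoef fun i j r => cgen (Gen.t i j r)

/-- Coefficients of `T⁺(u)` in powers of `u`. -/
def TPlus : ℕ → Idx m n → Idx m n → Comp m n := tPlusCoef fun i j r => cgen (Gen.s i j r)

/-- Coefficients of `T(u + m - n)` in powers of `u⁻¹`. -/
def TShift (N : ℕ) (i j : Idx m n) : Comp m n :=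
  shiftSeries (algebraMap ℂ (Comp m n) ((m : ℂ) - n)) (fun r => T m n r i j) N

variable {m n} in
/-- `U` gives the coefficients of `T⁺(u + m - n)` in powers of `u`: the coefficient of `uᴺ` is
the sum of the convergent series `∑_r binom(r + N, N) (m - n)ʳ T⁺_{r + N}`. -/
def IsTPlusShift (U : ℕ → Idx m n → Idx m n → Comp m n) : Prop :=
  ∀ N i j, HasSum
    (fun r : ℕ => (((r + N).choose N : ℂ) * ((m : ℂ) - n) ^ r) • TPlus m n (r + N) i j) (U N i j)

section Contraction

variable {m n} {A : Type*} [Ring A]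

/-- `∑_N M_N X^N`, where `M_N` is the element `∑ e_ij ⊗ (M_N)_ij` of `End V ⊗ A`. -/
def opSeries (M : ℕ → Idx m n → Idx m n → A) : PowerSeries (Matrix (Idx m n) (Idx m n) A) :=
  PowerSeries.mk fun N => evenOp (M N)

/-- `∑_N M_N X^N`, where `M_N` is the element `∑ e_ij ⊗ e_kl ⊗ (M_N)_ijkl` of
`End V ⊗ End V ⊗ A`. -/
def opSeries₂ (M : ℕ → Idx m n → Idx m n → Idx m n → Idx m n → A) :
    PowerSeries (Matrix (Idx m n × Idx m n) (Idx m n × Idx m n) A) :=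
  PowerSeries.mk fun N => evenOp₂ (M N)

/-- `P^{τ₂} M₁ (L₂⁻¹)^τ = P^{τ₂} ⊗ z` for series `M`, `L` with coefficients in `End V ⊗ A` and
a series `z` with coefficients in `A`; the invertibility of `L` is a part of the assertion. -/
def IsContraction (M L : ℕ → Idx m n → Idx m n → A) (z : ℕ → A) : Prop :=
  ∃ S : PowerSeries (Matrix (Idx m n) (Idx m n) A), opSeries L * S = 1 ∧ S * opSeries L = 1 ∧
    PowerSeries.C (evenOp₂ (transp₂ permP)) * opSeries₂ (fun N => leg₁ (M N)) *
        opSeries₂ (fun N => leg₂ (transp (evenCoef (PowerSeries.coeff N S)))) =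
      opSeries₂ fun N i j k l => transp₂ permP i j k l * z N

end Contraction

variable {m n}

/-- `z(u) = ∑_N z_N u⁻ᴺ` satisfies `P^{τ₂} T₁(u+m-n) (T₂(u)⁻¹)^τ = P^{τ₂} ⊗ z(u)`. -/
def IsQuantumContraction (z : ℕ → Comp m n) : Prop :=
  IsContraction (TShift m n) (T m n) z

/-- `z⁺(u) = ∑_N z_N uᴺ` satisfies `P^{τ₂} T₁⁺(u+m-n) (T₂⁺(u)⁻¹)^τ = P^{τ₂} ⊗ z⁺(u)`; the
convergence of the series defining `T⁺(u+m-n)` is a part of the assertion. -/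
def IsDualQuantumContraction (z : ℕ → Comp m n) : Prop :=
  ∃ U, IsTPlusShift U ∧ IsContraction U (TPlus m n) z

end Relations

end DoubleYangian

end

open Filter Topology

noncomputable section

namespace DoubleYangian

/-! ### Shifts of power series by central elements -/

section Shift

variable {R S : Type*} [Ring R] [Ring S]

/-! Put c = m - n and let K be the partial transpose of the flip P. Two identities drive everything:
P² = 1 and K² = cK. The first gives (1 - P/u)(1 + P/u) = 1 - u⁻²; the second gives crossing
symmetry, (1 - K/(u+c))(1 + K/u) = 1. For the normalized R-matrix the functional equation of g
matches the scalars produced by these two inversions.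

Existence of z(u). Multiply the exchange relation between T₁(u+c) and T₂(v) by T₂(v)⁻¹ on both sides
and set v = u: the R-matrix becomes a multiple of c - P. Transpose the first factor and multiply by
K on the right. Since (c - K)K = 0, one side vanishes and the other says c M₁K = K M₁K, where M =
T(u+c)^τ (T(u)⁻¹)^τ. As K M₁K is a scalar multiple of K and c ≠ 0, M is a scalar z(u). This is
`superT_mul_superT_eq_diagonal`, fed by `exists_diagonal_of_exchange`; the contraction identity is a
rewriting of M = z(u) (`isContraction_of_superT_mul`).

Centrality. When Y = T or T⁺ is moved through M, passing (T(u)⁻¹)^τ produces the transpose of an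
inverse R-matrix and passing T(u+c)^τ produces the transpose of the shifted R-matrix. By crossing
symmetry the two cancel (`commute_of_exchange`). Four applications, with T or T⁺ inside M and T or
T⁺ as Y, show that the coefficients of z and z⁺ commute with all generators, hence, by density and
continuity, with the whole completion.

The dual series needs analysis. In nonnegative powers of u the shift u ↦ u + c involves infinite
sums. It is therefore treated as a relation between series (`IsTaylorShift`), and exchange relations
are carried across it by uniqueness of limits. The inverse of T⁺(u) is a geometric series converging
in the extended dual Yangian. -/

theorem powerSeries_ringHom_ext {f g : PowerSeries R →+* PowerSeries S}
    (hC : ∀ a, f (PowerSeries.C a) = g (PowerSeries.C a))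
    (hX : f PowerSeries.X = g PowerSeries.X)
    (hfX : PowerSeries.constantCoeff (f PowerSeries.X) = 0) : f = g := by
  -- No continuity is assumed: as X goes to a multiple of X, the coefficient of degree n of the
  -- image of p is governed by lower coefficients of the image of the tail of p.
  obtain ⟨q, hq⟩ : ∃ q, f PowerSeries.X = PowerSeries.X * q := PowerSeries.X_dvd_iff.mpr hfX
  have key : ∀ N n, n < N → ∀ p, PowerSeries.coeff n (f p) = PowerSeries.coeff n (g p) := by
    intro N
    induction N with
    | zero => simp
    | succ N ih =>
      intro n hn p
      rw [PowerSeries.eq_X_mul_shift_add_const p]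
      simp only [map_add, map_mul, hC, ← hX, hq, mul_assoc]
      congr 1
      rcases n with _ | n
      · simp
      · rw [PowerSeries.coeff_succ_X_mul, PowerSeries.coeff_succ_X_mul,
          PowerSeries.coeff_mul, PowerSeries.coeff_mul]
        refine Finset.sum_congr rfl fun x hx => ?_
        have := Finset.HasAntidiagonal.antidiagonal.snd_le hx
        rw [ih x.2 (by omega)]
  exact RingHom.ext fun p => PowerSeries.ext fun N => key (N + 1) N N.lt_succ_self p

theorem shiftSeries_map (φ : R →+* S) (d : R) (f : ℕ → R) (N : ℕ) :
    φ (shiftSeries d f N) = shiftSeries (φ d) (fun r => φ (f r)) N := by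
  simp [shiftSeries, map_sum]

/-- The expansion of `(u + d)⁻ʳ` in powers of `X = u⁻¹`. -/
def shiftPow (d : R) (r : ℕ) : PowerSeries R :=
  PowerSeries.X ^ r * PowerSeries.mk fun n => Ring.choose (-(r : ℤ)) n • d ^ n

theorem coeff_shiftPow (d : R) (r N : ℕ) : PowerSeries.coeff N (shiftPow d r) =
    if r ≤ N then Ring.choose (-(r : ℤ)) (N - r) • d ^ (N - r) else 0 := by
  rw [shiftPow, PowerSeries.coeff_X_pow_mul']
  simp

/-- The Chu–Vandermonde identity for the exponents -r and -s. -/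
theorem shiftPow_mul (d : R) (r s : ℕ) : shiftPow d r * shiftPow d s = shiftPow d (r + s) := by
  rw [shiftPow, shiftPow, mul_assoc, ← mul_assoc _ (PowerSeries.X ^ s), ← PowerSeries.X_pow_mul,
    mul_assoc, ← mul_assoc, ← pow_add, shiftPow]
  congr 1
  ext n
  rw [PowerSeries.coeff_mul, PowerSeries.coeff_mk, Nat.cast_add, neg_add,
    Ring.add_choose_eq n (Commute.all _ _), Finset.sum_smul]
  refine Finset.sum_congr rfl fun x hx => ?_
  rw [PowerSeries.coeff_mk, PowerSeries.coeff_mk, smul_mul_smul_comm, ← pow_add,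
    Finset.HasAntidiagonal.mem_antidiagonal.mp hx]

/-- `shiftPow d r` starts in degree r, so any truncation at M ≥ N gives the same coefficient. The
freedom in M lets all coefficients entering a product share one range of summation. -/
theorem shiftSeries_eq_sum (d : R) (f : ℕ → R) {N M : ℕ} (h : N ≤ M) : shiftSeries d f N =
    PowerSeries.coeff N (∑ r ∈ Finset.range (M + 1), PowerSeries.C (f r) * shiftPow d r) := by
  rw [map_sum, shiftSeries]
  refine Finset.sum_subset_zero_on_sdiff (Finset.range_mono (by omega)) (fun r hr => ?_)
    fun r hr => ?_
  · rw [PowerSeries.coeff_C_mul, coeff_shiftPow, if_neg, mul_zero]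
    simp at hr; omega
  · rw [PowerSeries.coeff_C_mul, coeff_shiftPow, if_pos, mul_smul_comm]
    simp at hr; omega

theorem sum_range_antidiagonal {M : Type*} [AddCommMonoid M] (N : ℕ) (F : ℕ → ℕ → M)
    (hF : ∀ r s, N < r + s → F r s = 0) :
    ∑ r ∈ Finset.range (N + 1), ∑ s ∈ Finset.range (N + 1), F r s =
      ∑ k ∈ Finset.range (N + 1), ∑ x ∈ Finset.HasAntidiagonal.antidiagonal k, F x.1 x.2 := by
  rw [← Finset.sum_product' (f := F)]
  rw [← Finset.sum_filter_of_ne (p := fun x : ℕ × ℕ => x.1 + x.2 ∈ Finset.range (N + 1))]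
  · rw [← Finset.sum_fiberwise_of_maps_to (g := fun x : ℕ × ℕ => x.1 + x.2)
      (t := Finset.range (N + 1)) (fun x hx => (Finset.mem_filter.mp hx).2)]
    refine Finset.sum_congr rfl fun k hk => Finset.sum_congr ?_ fun _ _ => rfl
    ext ⟨r, s⟩
    simp at hk ⊢
    omega
  · intro x _ hx
    by_contra h
    exact hx (hF _ _ (by simpa using h))

/-- The substitution `f(u) ↦ f(u + d)` for series in `X = u⁻¹` and a central element `d`. -/
def shiftHom (d : R) (hd : ∀ a, Commute d a) : PowerSeries R →+* PowerSeries R where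
  toFun f := PowerSeries.mk (shiftSeries d fun r => PowerSeries.coeff r f)
  map_zero' := by ext N; simp [shiftSeries]
  map_add' f g := by ext N; simp [shiftSeries, add_mul, Finset.sum_add_distrib]
  map_one' := by
    ext N
    rw [PowerSeries.coeff_mk, shiftSeries, Finset.sum_eq_single 0]
    · rcases N with _ | N
      · simp
      · simp [PowerSeries.coeff_one, Ring.choose_zero_succ]
    · intro r _ hr
      simp [PowerSeries.coeff_one, hr]
    · simp
  map_mul' f g := by
    ext N
    have hc : ∀ r x, Commute (shiftPow d r) (PowerSeries.C x : PowerSeries R) := by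
      intro r x
      ext n
      rw [PowerSeries.coeff_mul_C, PowerSeries.coeff_C_mul, coeff_shiftPow]
      split_ifs
      · rw [smul_mul_assoc, mul_smul_comm, ((hd x).pow_left _).eq]
      · simp
    have h1 : PowerSeries.coeff N (PowerSeries.mk (shiftSeries d fun r => PowerSeries.coeff r f) *
          PowerSeries.mk (shiftSeries d fun r => PowerSeries.coeff r g)) =
        PowerSeries.coeff N ((∑ r ∈ Finset.range (N + 1),
          PowerSeries.C (PowerSeries.coeff r f) * shiftPow d r) *
          ∑ r ∈ Finset.range (N + 1), PowerSeries.C (PowerSeries.coeff r g) * shiftPow d r) := by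
      rw [PowerSeries.coeff_mul, PowerSeries.coeff_mul]
      refine Finset.sum_congr rfl fun x hx => ?_
      rw [PowerSeries.coeff_mk, PowerSeries.coeff_mk,
        shiftSeries_eq_sum d _ (Finset.HasAntidiagonal.antidiagonal.fst_le hx),
        shiftSeries_eq_sum d _ (Finset.HasAntidiagonal.antidiagonal.snd_le hx)]
    have h2 : ∀ r s, PowerSeries.C (PowerSeries.coeff r f) * shiftPow d r *
          (PowerSeries.C (PowerSeries.coeff s g) * shiftPow d s) =
        PowerSeries.C (PowerSeries.coeff r f * PowerSeries.coeff s g) * shiftPow d (r + s) := by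
      intro r s
      rw [mul_assoc, ← mul_assoc _ (PowerSeries.C _), (hc _ _).eq, mul_assoc, ← mul_assoc,
        shiftPow_mul, map_mul]
    rw [h1, PowerSeries.coeff_mk, shiftSeries_eq_sum d _ le_rfl, Finset.sum_mul_sum]
    simp only [h2, map_sum]
    rw [sum_range_antidiagonal]
    · refine Finset.sum_congr rfl fun k _ => ?_
      rw [PowerSeries.coeff_C_mul, PowerSeries.coeff_mul, Finset.sum_mul]
      refine Finset.sum_congr rfl fun x hx => ?_
      rw [PowerSeries.coeff_C_mul, Finset.HasAntidiagonal.mem_antidiagonal.mp hx]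
    · intro r s h
      rw [PowerSeries.coeff_C_mul, coeff_shiftPow, if_neg (by omega), mul_zero]

theorem coeff_shiftHom (d : R) (hd : ∀ a, Commute d a) (f : PowerSeries R) (N : ℕ) :
    PowerSeries.coeff N (shiftHom d hd f) = shiftSeries d (fun r => PowerSeries.coeff r f) N := by
  rw [← PowerSeries.coeff_mk N (shiftSeries d _)]
  rfl

theorem shiftHom_C (d : R) (hd : ∀ a, Commute d a) (a : R) :
    shiftHom d hd (PowerSeries.C a) = PowerSeries.C a := by
  ext N
  rw [coeff_shiftHom, shiftSeries, Finset.sum_eq_single 0]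
  · rcases N with _ | N
    · simp
    · simp [PowerSeries.coeff_C, Ring.choose_zero_succ]
  · intro r _ hr
    simp [PowerSeries.coeff_C, hr]
  · simp

theorem shiftHom_X_coeff (d : R) (hd : ∀ a, Commute d a) (N : ℕ) :
    PowerSeries.coeff N (shiftHom d hd PowerSeries.X) = PowerSeries.coeff N (shiftPow d 1) := by
  rw [coeff_shiftHom, shiftSeries_eq_sum d _ (Nat.le_succ N), map_sum,
    Finset.sum_eq_single 1]
  · simp
  · intro r _ hr
    simp [PowerSeries.coeff_X, hr]
  · simp

theorem constantCoeff_shiftHom_X (d : R) (hd : ∀ a, Commute d a) :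
    PowerSeries.constantCoeff (shiftHom d hd PowerSeries.X) = 0 := by
  rw [← PowerSeries.coeff_zero_eq_constantCoeff_apply, shiftHom_X_coeff, coeff_shiftPow]
  simp

/-- This is (u + d)⁻¹ = X/(1 + dX) for X = u⁻¹, a geometric series because binom(-1, n) = (-1)ⁿ. -/
theorem shiftHom_X (d : R) (hd : ∀ a, Commute d a) :
    shiftHom d hd PowerSeries.X * (1 + PowerSeries.C d * PowerSeries.X) = PowerSeries.X := by
  have h1 : shiftHom d hd PowerSeries.X = shiftPow d 1 :=
    PowerSeries.ext fun N => shiftHom_X_coeff d hd N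
  have hz : ∀ n, Ring.choose (-1 : ℤ) n = (-1) ^ n := by
    intro n
    rw [Ring.choose_neg']
    simp [Ring.multichoose_one, Int.negOnePow_def, Units.smul_def]
  rw [h1, shiftPow, pow_one, mul_assoc]
  conv_rhs => rw [← mul_one PowerSeries.X]
  congr 1
  ext n
  rw [mul_add, mul_one, ← mul_assoc, map_add]
  rcases n with _ | n
  · simp
  · rw [PowerSeries.coeff_succ_mul_X, PowerSeries.coeff_mul_C]
    simp [hz, PowerSeries.coeff_one, pow_succ, mul_assoc]

theorem shiftHom_X_unique (d : R) (hd : ∀ a, Commute d a) {f : PowerSeries R}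
    (h : f * (1 + PowerSeries.C d * PowerSeries.X) = PowerSeries.X) :
    f = shiftHom d hd PowerSeries.X := by
  have hu : IsUnit (1 + PowerSeries.C d * PowerSeries.X) :=
    ⟨⟨_, PowerSeries.invOfUnit _ 1, PowerSeries.mul_invOfUnit _ 1 (by simp),
      PowerSeries.invOfUnit_mul _ 1 (by simp)⟩, rfl⟩
  exact hu.mul_right_cancel (h.trans (shiftHom_X d hd).symm)

/-- Both sides are ring homomorphisms fixing the constants, so it suffices to compare the images of
X, and these are characterized by `shiftHom_X_unique`. -/
theorem shiftHom_comp (c d e : R) (hc : ∀ a, Commute c a) (hd : ∀ a, Commute d a)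
    (he : ∀ a, Commute e a) (h : e = c + d) (f : PowerSeries R) :
    shiftHom c hc (shiftHom d hd f) = shiftHom e he f := by
  have key : (shiftHom c hc).comp (shiftHom d hd) = shiftHom e he := by
    symm
    refine powerSeries_ringHom_ext (fun a => ?_) ?_ (constantCoeff_shiftHom_X _ _)
    · simp [shiftHom_C]
    · symm
      refine shiftHom_X_unique _ _ ?_
      have h1 := congrArg (shiftHom c hc) (shiftHom_X d hd)
      rw [map_mul, map_add, map_mul, map_one, shiftHom_C] at h1
      have h2 := shiftHom_X c hc
      have h3 := h2
      rw [← h1, mul_assoc, add_mul, one_mul, mul_assoc (PowerSeries.C d), h2] at h3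
      rw [RingHom.comp_apply, h, map_add, add_mul, ← add_assoc, h3]
  exact RingHom.congr_fun key f

theorem shiftHom_map (φ : R →+* S) (d : R) (hd : ∀ a, Commute d a) (hd' : ∀ a, Commute (φ d) a)
    (f : PowerSeries R) :
    PowerSeries.map φ (shiftHom d hd f) = shiftHom (φ d) hd' (PowerSeries.map φ f) := by
  ext N
  simp [coeff_shiftHom, shiftSeries_map]

end Shift

/-! ### Matrices acting on `V ⊗ V` -/

section TensorMatrices

variable {m n : ℕ} {E : Type*} [Ring E]

/-- The index set of the standard basis of `V ⊗ V`. -/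
abbrev Idx₂ (m n : ℕ) : Type := Idx m n × Idx m n

/-- The action of an even element in the first tensor factor of `V ⊗ V`. -/
def legL (X : Matrix (Idx m n) (Idx m n) E) : Matrix (Idx₂ m n) (Idx₂ m n) E :=
  fun a b => if a.2 = b.2 then (-1) ^ ((par a.1 + par b.1) * par a.2) * X a.1 b.1 else 0

/-- The action of an even element in the second tensor factor of `V ⊗ V`. -/
def legR (X : Matrix (Idx m n) (Idx m n) E) : Matrix (Idx₂ m n) (Idx₂ m n) E :=
  fun a b => if a.1 = b.1 then X a.2 b.2 else 0

/-- The graded flip of `V ⊗ V`. -/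
def flipM : Matrix (Idx₂ m n) (Idx₂ m n) E :=
  fun a b => if a.1 = b.2 ∧ a.2 = b.1 then (-1) ^ (par a.1 * par a.2) else 0

/-- The partial transpose of the graded flip in the first tensor factor. -/
def contrM : Matrix (Idx₂ m n) (Idx₂ m n) E :=
  fun a b => if a.1 = a.2 ∧ b.1 = b.2 then (-1) ^ par a.1 else 0

/-- The matrix of the transpose of an even element. -/
def superT (X : Matrix (Idx m n) (Idx m n) E) : Matrix (Idx m n) (Idx m n) E :=
  fun i j => (-1) ^ (par i * par j + par i) * X j i

/-- The partial transposition in the first tensor factor. -/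
def ptL (M : Matrix (Idx₂ m n) (Idx₂ m n) E) : Matrix (Idx₂ m n) (Idx₂ m n) E :=
  fun a b => (-1) ^ (par a.1 * par b.1 + par a.1) * M (b.1, a.2) (a.1, b.2)

theorem legL_mul_apply (X : Matrix (Idx m n) (Idx m n) E) (M : Matrix (Idx₂ m n) (Idx₂ m n) E)
    (a b : Idx₂ m n) : (legL X * M) a b =
      ∑ p, (-1) ^ ((par a.1 + par p) * par a.2) * X a.1 p * M (p, a.2) b := by
  simp [Matrix.mul_apply, legL, Fintype.sum_prod_type]

theorem legR_mul_apply (X : Matrix (Idx m n) (Idx m n) E) (M : Matrix (Idx₂ m n) (Idx₂ m n) E)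
    (a b : Idx₂ m n) : (legR X * M) a b = ∑ p, X a.2 p * M (a.1, p) b := by
  simp [Matrix.mul_apply, legR, Fintype.sum_prod_type]

theorem mul_legR_apply (X : Matrix (Idx m n) (Idx m n) E) (M : Matrix (Idx₂ m n) (Idx₂ m n) E)
    (a b : Idx₂ m n) : (M * legR X) a b = ∑ p, M a (b.1, p) * X p b.2 := by
  simp [Matrix.mul_apply, legR, Fintype.sum_prod_type]

theorem flip_mul_apply (M : Matrix (Idx₂ m n) (Idx₂ m n) E)
    (a b : Idx₂ m n) : (flipM * M : Matrix (Idx₂ m n) (Idx₂ m n) E) a b = (-1) ^ (par a.1 * par a.2) * M (a.2, a.1) b := by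
  simp [Matrix.mul_apply, flipM, Fintype.sum_prod_type, ite_and]

theorem mul_flip_apply (M : Matrix (Idx₂ m n) (Idx₂ m n) E)
    (a b : Idx₂ m n) : (M * flipM : Matrix (Idx₂ m n) (Idx₂ m n) E) a b = M a (b.2, b.1) * (-1) ^ (par b.1 * par b.2) := by
  simp [Matrix.mul_apply, flipM, Fintype.sum_prod_type, ite_and, mul_comm]

theorem legL_mul (X Y : Matrix (Idx m n) (Idx m n) E) : legL X * legL Y = legL (X * Y) := by
  ext ⟨i, k⟩ ⟨j, l⟩
  rw [legL_mul_apply]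
  by_cases h : k = l
  · subst h
    simp only [legL, if_true, Matrix.mul_apply, Finset.mul_sum]
    refine Finset.sum_congr rfl fun p _ => ?_
    rcases i <;> rcases j <;> rcases k <;> rcases p <;> simp [par]
  · simp [legL, h]

theorem legR_mul (X Y : Matrix (Idx m n) (Idx m n) E) : legR X * legR Y = legR (X * Y) := by
  ext ⟨i, k⟩ ⟨j, l⟩
  rw [legR_mul_apply]
  by_cases h : i = j <;> simp [legR, h, Matrix.mul_apply]

theorem legL_diagonal (z : E) :
    legL (Matrix.diagonal fun _ => z) = (Matrix.diagonal fun _ => z : Matrix (Idx₂ m n) _ E) := by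
  ext ⟨i, k⟩ ⟨j, l⟩
  by_cases h : k = l <;> by_cases h' : i = j <;> simp [legL, h, h']

theorem flip_mul_flip : (flipM * flipM : Matrix (Idx₂ m n) (Idx₂ m n) E) = 1 := by
  ext ⟨i, k⟩ ⟨j, l⟩
  rw [flip_mul_apply]
  simp only [flipM, Matrix.one_apply, Prod.mk.injEq]
  by_cases h : i = j <;> by_cases h' : k = l <;> simp [h, h']
  rcases j <;> rcases l <;> simp [par]

theorem flip_conj_legR (X : Matrix (Idx m n) (Idx m n) E) :
    (flipM * legR X * flipM : Matrix (Idx₂ m n) (Idx₂ m n) E) = legL X := by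
  ext ⟨i, k⟩ ⟨j, l⟩
  rw [mul_flip_apply, flip_mul_apply]
  simp only [legR, legL]
  by_cases h : k = l
  · subst h
    rcases i <;> rcases j <;> rcases k <;> simp [par]
  · simp [h]

theorem flip_mul_legR (X : Matrix (Idx m n) (Idx m n) E) :
    (flipM * legR X : Matrix (Idx₂ m n) (Idx₂ m n) E) = legL X * flipM := by
  rw [← flip_conj_legR, mul_assoc, flip_mul_flip, mul_one]

theorem flip_mul_legL (X : Matrix (Idx m n) (Idx m n) E) :
    (flipM * legL X : Matrix (Idx₂ m n) (Idx₂ m n) E) = legR X * flipM := by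
  rw [← flip_conj_legR, ← mul_assoc, ← mul_assoc, flip_mul_flip, one_mul]

theorem contr_mul_apply (M : Matrix (Idx₂ m n) (Idx₂ m n) E) (a b : Idx₂ m n) :
    (contrM * M : Matrix (Idx₂ m n) (Idx₂ m n) E) a b =
      if a.1 = a.2 then ∑ p, (-1) ^ par a.1 * M (p, p) b else 0 := by
  by_cases h : a.1 = a.2 <;> simp [Matrix.mul_apply, contrM, Fintype.sum_prod_type, h]

theorem mul_contr_apply (M : Matrix (Idx₂ m n) (Idx₂ m n) E) (a b : Idx₂ m n) :
    (M * contrM : Matrix (Idx₂ m n) (Idx₂ m n) E) a b =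
      if b.1 = b.2 then ∑ p, M a (p, p) * (-1) ^ par p else 0 := by
  by_cases h : b.1 = b.2 <;> simp [Matrix.mul_apply, contrM, Fintype.sum_prod_type, h]

/-- The factor is the supertrace of the identity of ℂ^{m|n}. -/
theorem contr_mul_contr :
    (contrM * contrM : Matrix (Idx₂ m n) (Idx₂ m n) E) = ((m : ℤ) - n) • contrM := by
  ext ⟨i, k⟩ ⟨j, l⟩
  rw [mul_contr_apply]
  by_cases h : i = k
  · by_cases h' : j = l
    · rcases i <;> simp [contrM, ← h, ← h', par, sub_eq_add_neg]
    · simp [contrM, h']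
  · simp [contrM, h]

theorem ptL_add (M N : Matrix (Idx₂ m n) (Idx₂ m n) E) : ptL (M + N) = ptL M + ptL N := by
  ext; simp [ptL, mul_add]

theorem ptL_smul {Z : Type*} [CommRing Z] [Algebra Z E] (z : Z)
    (M : Matrix (Idx₂ m n) (Idx₂ m n) E) : ptL (z • M) = z • ptL M := by
  ext; simp [ptL]

/-- In this and the next five lemmas the entries of X and Y occur in the same order on both sides,
so no commutation between them is needed. Transposing the first factor only moves X to the other
side of the flip. -/
theorem ptL_legL_mul_legR (X Y : Matrix (Idx m n) (Idx m n) E) :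
    ptL (legL X * legR Y) = legL (superT X) * legR Y := by
  ext ⟨i, k⟩ ⟨j, l⟩
  simp only [ptL, mul_legR_apply, legL, superT]
  rcases i <;> rcases j <;> rcases k <;> simp [par]

theorem ptL_legR_mul_legL (X Y : Matrix (Idx m n) (Idx m n) E) :
    ptL (legR Y * legL X) = legR Y * legL (superT X) := by
  ext ⟨i, k⟩ ⟨j, l⟩
  simp only [ptL, legR_mul_apply, legL, superT]
  rcases i <;> rcases j <;> rcases l <;> simp [par]

theorem ptL_flip_mul (X Y : Matrix (Idx m n) (Idx m n) E) :
    ptL (flipM * (legL X * legR Y)) = legL (superT X) * contrM * legR Y := by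
  ext ⟨i, k⟩ ⟨j, l⟩
  simp only [ptL, mul_legR_apply, flip_mul_apply, mul_contr_apply, legL, superT]
  rcases i <;> rcases j <;> rcases k <;>  simp [par]

theorem ptL_mul_flip (X Y : Matrix (Idx m n) (Idx m n) E) :
    ptL (legR Y * legL X * flipM) = legR Y * contrM * legL (superT X) := by
  ext ⟨i, k⟩ ⟨j, l⟩
  rw [mul_assoc, mul_assoc]
  simp only [ptL, legR_mul_apply, mul_flip_apply, contr_mul_apply, legL, superT]
  rcases i <;> rcases j <;> rcases l <;>  simp [par]

theorem ptL_legR_flip_legL (X Y : Matrix (Idx m n) (Idx m n) E) :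
    ptL (legR Y * flipM * legL X) = legR Y * legL (superT X) * contrM := by
  ext ⟨i, k⟩ ⟨j, l⟩
  rw [mul_assoc, mul_assoc]
  simp only [ptL, legR_mul_apply, flip_mul_apply, mul_contr_apply, legL, superT]
  rcases i <;> rcases j <;> rcases l <;> 
    first
    | (simp [par]; done)
    | simp [par, add_comm]

theorem ptL_legL_flip_legR (X Y : Matrix (Idx m n) (Idx m n) E) :
    ptL (legL X * flipM * legR Y) = contrM * legL (superT X) * legR Y := by
  ext ⟨i, k⟩ ⟨j, l⟩
  simp only [ptL, mul_legR_apply, mul_flip_apply, contr_mul_apply, legL, superT]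
  rcases i <;> rcases j <;> rcases k <;> 
    first
    | (simp [par]; done)
    | simp [par, add_comm, eq_comm]

/-! ### Crossing symmetry and exchange relations -/

section Crossing

variable {Z : Type*} [CommRing Z] [Algebra Z E]

/-- The operator `α + β P` on `V ⊗ V`. -/
def rOp (α β : Z) : Matrix (Idx₂ m n) (Idx₂ m n) E := α • 1 + β • flipM

/-- The operator `α + β P^τ` on `V ⊗ V`. -/
def rOpT (α β : Z) : Matrix (Idx₂ m n) (Idx₂ m n) E := α • 1 + β • contrM

theorem rOp_mul_rOp (α β κ μ : Z) : (rOp α β * rOp κ μ : Matrix (Idx₂ m n) (Idx₂ m n) E) =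
    rOp (α * κ + β * μ) (α * μ + β * κ) := by
  simp only [rOp, add_mul, mul_add, smul_mul_assoc, mul_smul_comm, one_mul, mul_one,
    flip_mul_flip, add_smul, mul_smul]
  module

/-- The last term comes from K² = (m - n)K; it is the reason why crossing symmetry involves a shift
by m - n. -/
theorem rOpT_mul_rOpT (α β κ μ : Z) : (rOpT α β * rOpT κ μ : Matrix (Idx₂ m n) (Idx₂ m n) E) =
    rOpT (α * κ) (α * μ + β * κ + ((m : Z) - n) * (β * μ)) := by
  have h : (contrM * contrM : Matrix (Idx₂ m n) (Idx₂ m n) E) = ((m : Z) - n) • contrM := by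
    rw [contr_mul_contr, ← Int.cast_smul_eq_zsmul Z]
    simp
  simp only [rOpT, add_mul, mul_add, smul_mul_assoc, mul_smul_comm, one_mul, mul_one, h,
    add_smul, mul_smul]
  module

theorem flip_mul_rOp (α β : Z) : flipM * rOp α β = (rOp α β * flipM :
    Matrix (Idx₂ m n) (Idx₂ m n) E) := by
  simp [rOp, mul_add, add_mul]

theorem ptL_rOp_mul (α β : Z) (X Y : Matrix (Idx m n) (Idx m n) E) :
    ptL (rOp α β * (legL X * legR Y)) = legL (superT X) * rOpT α β * legR Y := by
  simp only [rOp, rOpT, add_mul, mul_add, smul_mul_assoc, mul_smul_comm, one_mul, mul_one,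
    ptL_add, ptL_smul, ptL_flip_mul, ptL_legL_mul_legR]

theorem ptL_mul_rOp (α β : Z) (X Y : Matrix (Idx m n) (Idx m n) E) :
    ptL (legR Y * legL X * rOp α β) = legR Y * rOpT α β * legL (superT X) := by
  simp only [rOp, rOpT, add_mul, mul_add, smul_mul_assoc, mul_smul_comm, mul_one,
    ptL_add, ptL_smul, ptL_mul_flip, ptL_legR_mul_legL]

theorem ptL_legR_rOp_legL (α β : Z) (X Y : Matrix (Idx m n) (Idx m n) E) :
    ptL (legR Y * rOp α β * legL X) = legR Y * legL (superT X) * rOpT α β := by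
  simp only [rOp, rOpT, add_mul, mul_add, smul_mul_assoc, mul_smul_comm, mul_one,
    ptL_add, ptL_smul, ptL_legR_flip_legL, ptL_legR_mul_legL]

theorem ptL_legL_rOp_legR (α β : Z) (X Y : Matrix (Idx m n) (Idx m n) E) :
    ptL (legL X * rOp α β * legR Y) = rOpT α β * legL (superT X) * legR Y := by
  simp only [rOp, rOpT, add_mul, mul_add, smul_mul_assoc, mul_smul_comm, one_mul, mul_one,
    ptL_add, ptL_smul, ptL_legL_flip_legR, ptL_legL_mul_legR]

theorem legL_one : legL (1 : Matrix (Idx m n) (Idx m n) E) = 1 := by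
  rw [← Matrix.diagonal_one, legL_diagonal, Matrix.diagonal_one]

theorem legR_one : legR (1 : Matrix (Idx m n) (Idx m n) E) = 1 := by
  ext ⟨i, k⟩ ⟨j, l⟩
  by_cases h : i = j <;> simp [legR, Matrix.one_apply, h]

/-- If `X'^τ (X⁻¹)^τ = z`, where `X` and `X'` satisfy exchange relations with `Y` whose
coefficient matrices are related by crossing symmetry, then `z` commutes with `Y`. -/
theorem commute_of_exchange {X S X' Y : Matrix (Idx m n) (Idx m n) E} {z : E}
    {αa βa αb βb αa' βa' αb' βb' κa μa κb μb ka kb la lb : Z}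
    (h : rOp αa βa * (legL X * legR Y) = legR Y * legL X * rOp αb βb)
    (h' : rOp αa' βa' * (legL X' * legR Y) = legR Y * legL X' * rOp αb' βb')
    (hXS : X * S = 1) (hSX : S * X = 1)
    (hz : superT X' * superT S = Matrix.diagonal fun _ => z)
    (ha₁ : αa * κa + βa * μa = ka) (ha₂ : αa * μa + βa * κa = 0)
    (hb₁ : αb * κb + βb * μb = kb) (hb₂ : αb * μb + βb * κb = 0)
    (ha₃ : αa' * κa = la) (ha₄ : αa' * μa + βa' * κa + ((m : Z) - n) * (βa' * μa) = 0)
    (hb₃ : αb' * κb = lb) (hb₄ : αb' * μb + βb' * κb + ((m : Z) - n) * (βb' * μb) = 0)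
    (hkl : kb * la = ka * lb) (hreg : ∀ e : E, (kb * la) • e = 0 → e = 0) (k l : Idx m n) :
    z * Y k l = Y k l * z := by
  have hS1 : legL X * legL S = 1 := by rw [legL_mul, hXS, legL_one]
  have hS2 : legL S * legL X = 1 := by rw [legL_mul, hSX, legL_one]
  -- κ + μP inverts α + βP up to the scalar k, so the R-matrices can be moved to the opposite sides.
  have e1 : ka • (legL X * legR Y * rOp κb μb) = kb • (rOp κa μa * (legR Y * legL X)) := by
    have ra : (rOp κa μa * rOp αa βa : Matrix (Idx₂ m n) (Idx₂ m n) E) = ka • 1 := by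
      have h₁ : κa * αa + μa * βa = ka := by linear_combination ha₁
      have h₂ : κa * βa + μa * αa = 0 := by linear_combination ha₂
      rw [rOp_mul_rOp, h₁, h₂, rOp, zero_smul, add_zero]
    have rb : (rOp αb βb * rOp κb μb : Matrix (Idx₂ m n) (Idx₂ m n) E) = kb • 1 := by
      rw [rOp_mul_rOp, hb₁, hb₂, rOp, zero_smul, add_zero]
    have := congrArg (fun M => rOp κa μa * M * rOp κb μb) h
    simp only [← mul_assoc] at this
    rw [ra] at this
    simp only [mul_assoc, rb] at this
    simpa [mul_assoc] using this
  -- Multiplying by X⁻¹ on both sides yields the exchange relation for X⁻¹ and Y, now in a form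
  -- whose partial transpose is again a product.
  have e2 : ka • (legR Y * rOp κb μb * legL S) = kb • (legL S * rOp κa μa * legR Y) := by
    have := congrArg (fun M => legL S * M * legL S) e1
    simpa only [mul_smul_comm, smul_mul_assoc, mul_assoc, hS1, mul_one,
      ← mul_assoc (legL S) (legL X), hS2, one_mul] using this
  have e3 := congrArg ptL e2
  rw [ptL_smul, ptL_smul, ptL_legR_rOp_legL, ptL_legL_rOp_legR] at e3
  have e4 := congrArg ptL h'
  rw [ptL_rOp_mul, ptL_mul_rOp] at e4
  have ra : (rOpT αa' βa' * rOpT κa μa : Matrix (Idx₂ m n) (Idx₂ m n) E) = la • 1 := by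
    rw [rOpT_mul_rOpT, ha₃, ha₄, rOpT, zero_smul, add_zero]
  have rb : (rOpT αb' βb' * rOpT κb μb : Matrix (Idx₂ m n) (Idx₂ m n) E) = lb • 1 := by
    rw [rOpT_mul_rOpT, hb₃, hb₄, rOpT, zero_smul, add_zero]
  have hzz : legL (superT X') * legL (superT S) = Matrix.diagonal fun _ => z := by
    rw [legL_mul, hz, legL_diagonal]
  -- The nonzero entries of K are signs and Z acts centrally, so z passes through.
  have hcomm : ∀ α β : Z, (rOpT α β : Matrix (Idx₂ m n) (Idx₂ m n) E) *
      (Matrix.diagonal fun _ => z) = (Matrix.diagonal fun _ => z) * rOpT α β := by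
    intro α β
    ext a b
    rw [Matrix.mul_diagonal, Matrix.diagonal_mul]
    simp only [rOpT, Matrix.add_apply, Matrix.smul_apply, Matrix.one_apply, contrM]
    have h1 : ∀ i : Idx m n, (-1) ^ par i * z = z * (-1) ^ par i := fun i =>
      ((Commute.neg_one_left z).pow_left _).eq
    split_ifs <;> simp [add_mul, mul_add, h1]
  -- Crossing symmetry inserts R'^T (R⁻¹)^T between X'^τ and S^τ. Then Y passes S^τ by `e3` and X'^τ
  -- by `e4`, and crossing symmetry removes the two R-matrices left on the other side.
  have e5 : (kb * la) • ((Matrix.diagonal fun _ => z) * legR Y) =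
      (kb * la) • (legR Y * Matrix.diagonal fun _ => z) := by
    calc (kb * la) • ((Matrix.diagonal fun _ => z) * legR Y)
        = kb • (legL (superT X') * (la • 1) * legL (superT S) * legR Y) := by
          rw [← hzz]; simp [mul_smul, mul_assoc]
      _ = legL (superT X') * rOpT αa' βa' *
            (kb • (rOpT κa μa * legL (superT S) * legR Y)) := by
          rw [← ra]; simp [mul_assoc]
      _ = ka • (legL (superT X') * rOpT αa' βa' * legR Y * (legL (superT S) * rOpT κb μb)) := by
          rw [← e3]; simp [mul_assoc]
      _ = ka • (legR Y * (rOpT αb' βb' * (Matrix.diagonal fun _ => z) * rOpT κb μb)) := by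
          rw [e4, ← hzz]; simp [mul_assoc]
      _ = (kb * la) • (legR Y * Matrix.diagonal fun _ => z) := by
          rw [hcomm, mul_assoc, rb, hkl]; simp [mul_smul]
  have e6 := congrFun (congrFun e5 (k, k)) (k, l)
  simp only [Matrix.smul_apply, Matrix.diagonal_mul, Matrix.mul_diagonal, legR, if_true] at e6
  rw [← sub_eq_zero]
  apply hreg
  rw [smul_sub, e6, sub_self]

end Crossing

end TensorMatrices

/-! ### Interchanging the legs, and the scalar obtained at the crossing point -/

section TensorMatrices

variable {m n : ℕ} {E : Type*} [Ring E] {Z : Type*} [CommRing Z] [Algebra Z E]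

/-- Conjugation by P swaps the legs, and multiplying by α - βP on both sides inverts the R-matrices,
since (α + βP)(α - βP) = α² - β². Afterwards Y occupies the leg that is transposed in
`commute_of_exchange`. -/
theorem exchange_flip {X Y : Matrix (Idx m n) (Idx m n) E} {αa βa αb βb : Z}
    (h : rOp αa βa * (legL X * legR Y) = legR Y * legL X * rOp αb βb) :
    rOp ((αb * αb - βb * βb) * αa) (-((αb * αb - βb * βb) * βa)) * (legL Y * legR X) =
      legR X * legL Y * rOp ((αa * αa - βa * βa) * αb) (-((αa * αa - βa * βa) * βb)) := by
  have hs : ∀ c α β : Z, (rOp (c * α) (-(c * β)) : Matrix (Idx₂ m n) (Idx₂ m n) E) =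
      c • rOp α (-β) := by
    intro c α β
    simp [rOp, mul_smul]
  have hk : ∀ α β : Z, (rOp α (-β) * rOp α β : Matrix (Idx₂ m n) (Idx₂ m n) E) =
      (α * α - β * β) • 1 := by
    intro α β
    rw [rOp_mul_rOp, rOp, show α * α + -β * β = α * α - β * β by ring,
      show α * β + -β * α = 0 by ring, zero_smul, add_zero]
  have hk' : ∀ α β : Z, (rOp α β * rOp α (-β) : Matrix (Idx₂ m n) (Idx₂ m n) E) =
      (α * α - β * β) • 1 := by
    intro α β
    rw [rOp_mul_rOp, rOp, show α * α + β * -β = α * α - β * β by ring,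
      show α * -β + β * α = 0 by ring, zero_smul, add_zero]
  have h1 : rOp αa βa * (legR X * legL Y) = legL Y * legR X * rOp αb βb := by
    have h2 := congrArg (fun M => flipM * M * flipM) h
    simp only [← mul_assoc, flip_mul_rOp] at h2
    simp only [mul_assoc] at h2
    rw [← flip_mul_rOp, ← mul_assoc flipM (legL X), flip_mul_legL, mul_assoc,
      ← mul_assoc flipM (legR Y), flip_mul_legR, mul_assoc, flip_mul_flip, mul_one,
      ← mul_assoc flipM (legR Y), flip_mul_legR, mul_assoc, ← mul_assoc flipM (legL X),
      flip_mul_legL, mul_assoc, ← mul_assoc flipM flipM, flip_mul_flip, one_mul] at h2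
    rw [h2, mul_assoc]
  have h3 := congrArg (fun M => rOp αa (-βa) * M * rOp αb (-βb)) h1
  simp only [← mul_assoc] at h3
  rw [hk] at h3
  simp only [mul_assoc, hk'] at h3
  rw [hs, hs]
  simpa [mul_assoc] using h3.symm

theorem legR_mul_contr (X : Matrix (Idx m n) (Idx m n) E) :
    (legR X * contrM : Matrix (Idx₂ m n) (Idx₂ m n) E) = legL (superT X) * contrM := by
  ext ⟨i, k⟩ ⟨j, l⟩
  simp only [mul_contr_apply, legR, legL, superT]
  rcases i <;> rcases k <;> simp [par]

/-- The residue of an exchange relation at the crossing point makes the product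
`X^τ S^τ` scalar. -/
theorem superT_mul_superT_eq_diagonal [Algebra ℂ E] {X S : Matrix (Idx m n) (Idx m n) E}
    (hmn : m ≠ n)
    (h : legR S * rOp ((m : ℂ) - n) (-1) * legL X = legL X * rOp ((m : ℂ) - n) (-1) * legR S) :
    ∃ z : E, superT X * superT S = Matrix.diagonal fun _ => z := by
  have hc : (m : ℂ) - n ≠ 0 := sub_ne_zero.mpr (by exact_mod_cast hmn)
  set c := (m : ℂ) - n with hcdef
  set M := superT X * superT S with hM
  have h1 := congrArg ptL h
  rw [ptL_legR_rOp_legL, ptL_legL_rOp_legR] at h1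
  -- At the crossing point the transposed R-matrix c - K annihilates K.
  have h0 : (rOpT c (-1) * contrM : Matrix (Idx₂ m n) (Idx₂ m n) E) = 0 := by
    have : (contrM : Matrix (Idx₂ m n) (Idx₂ m n) E) = rOpT (0 : ℂ) 1 := by simp [rOpT]
    rw [this, rOpT_mul_rOpT, rOpT, ← hcdef]
    simp
  have h2 : c • (legL M * contrM) = contrM * (legL M * contrM) := by
    have h3 := congrArg (· * contrM) h1
    simp only [mul_assoc, h0, mul_zero] at h3
    rw [legR_mul_contr, ← mul_assoc (legL _) (legL _), legL_mul, ← hM] at h3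
    rw [rOpT, add_mul, smul_one_mul, neg_one_smul, neg_mul, ← sub_eq_add_neg] at h3
    exact (sub_eq_zero.mp h3.symm)
  -- Comparing entries of cM₁K = KM₁K: off-diagonal entries of M vanish, and c times each diagonal
  -- entry is the signed trace of M.
  refine ⟨c⁻¹ • ∑ p, (-1) ^ par p * M p p, ?_⟩
  ext i k
  have h3 := congrFun (congrFun h2 (i, k)) (i, i)
  simp only [Matrix.smul_apply, contr_mul_apply, mul_contr_apply, if_true, legL] at h3
  by_cases hik : i = k
  · subst hik
    have h4 : c • M i i = ∑ p, (-1) ^ par p * M p p := by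
      rcases i
      · simpa [par, ← sub_eq_add_neg] using h3
      · rw [← neg_inj]
        simpa [par, ← sub_eq_add_neg, neg_add_eq_sub] using h3
    rw [Matrix.diagonal_apply_eq, ← h4, smul_smul, inv_mul_cancel₀ hc, one_smul]
  · simp [hik] at h3
    simpa [Matrix.diagonal_apply_ne _ hik] using h3.resolve_left hc

end TensorMatrices

/-! ### The contraction identity in terms of matrices of series -/

section Contraction

variable {m n : ℕ} {A : Type*} [Ring A]

/-- The matrix of power series corresponding to a power series with matrix coefficients. -/
def matOfSeries {J R : Type*} [Fintype J] [DecidableEq J] [Ring R] :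
    PowerSeries (Matrix J J R) →+* Matrix J J (PowerSeries R) where
  toFun F := Matrix.of fun p q => PowerSeries.mk fun N => PowerSeries.coeff N F p q
  map_zero' := by ext; simp
  map_add' F G := by ext; simp
  map_one' := by
    ext p q N
    by_cases h : p = q <;> rcases N with _ | N <;>
      simp [PowerSeries.coeff_one, h, Matrix.one_apply]
  map_mul' F G := by
    ext p q N
    simp only [Matrix.of_apply, PowerSeries.coeff_mk, PowerSeries.coeff_mul, Matrix.sum_apply,
      Matrix.mul_apply, map_sum]
    rw [Finset.sum_comm]

theorem coeff_matOfSeries {J R : Type*} [Fintype J] [DecidableEq J] [Ring R]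
    (F : PowerSeries (Matrix J J R)) (p q : J) (N : ℕ) :
    PowerSeries.coeff N (matOfSeries F p q) = PowerSeries.coeff N F p q := by
  simp [matOfSeries]

theorem matOfSeries_injective {J R : Type*} [Fintype J] [DecidableEq J] [Ring R] :
    Function.Injective (matOfSeries : PowerSeries (Matrix J J R) →+* _) := by
  intro F G h
  ext N p q
  rw [← coeff_matOfSeries, h, coeff_matOfSeries]

theorem evenOp₂_leg₁ (x : Idx m n → Idx m n → A) : evenOp₂ (leg₁ x) = legL (evenOp x) := by
  ext ⟨i, k⟩ ⟨j, l⟩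
  simp only [evenOp₂, leg₁, legL, evenOp]
  rcases i <;> rcases j <;> rcases k <;> rcases l <;> simp [par, pow_succ]

theorem evenOp₂_leg₂ (x : Idx m n → Idx m n → A) : evenOp₂ (leg₂ x) = legR (evenOp x) := by
  ext ⟨i, k⟩ ⟨j, l⟩
  simp only [evenOp₂, leg₂, legR, evenOp]
  rcases i <;> rcases j <;> rcases k <;> rcases l <;> simp [par, pow_succ]

theorem evenOp₂_permP : (evenOp₂ permP : Matrix (Idx₂ m n) (Idx₂ m n) A) = flipM := by
  ext ⟨i, k⟩ ⟨j, l⟩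
  simp only [evenOp₂, permP, flipM]
  rcases i <;> rcases j <;> rcases k <;> rcases l <;> simp [par, pow_succ, eq_comm, and_comm]

theorem evenOp_transp_evenCoef (X : Matrix (Idx m n) (Idx m n) A) :
    evenOp (transp (evenCoef X)) = superT X := by
  ext i j
  simp only [evenOp, transp, evenCoef, superT]
  rcases i <;> rcases j <;> simp [par]

theorem evenOp₂_transp₂_permP_mul (z : A) (a b : Idx₂ m n) :
    evenOp₂ (fun i j k l => transp₂ permP i j k l * z) a b =
      if a.1 = a.2 ∧ b.1 = b.2 then (-1) ^ par b.1 * z else 0 := by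
  obtain ⟨i, k⟩ := a
  obtain ⟨j, l⟩ := b
  simp only [evenOp₂, transp₂, permP]
  rcases i <;> rcases j <;> rcases k <;> rcases l <;> simp [par, pow_succ, eq_comm, and_comm]

theorem evenOp₂_transp₂_permP (a b : Idx₂ m n) :
    (evenOp₂ (transp₂ permP) : Matrix _ _ A) a b =
      if a.1 = a.2 ∧ b.1 = b.2 then (-1) ^ par b.1 else 0 := by
  simpa using evenOp₂_transp₂_permP_mul (1 : A) a b

theorem matOfSeries_opSeries₂_leg₁ (M : ℕ → Idx m n → Idx m n → A) :
    matOfSeries (opSeries₂ fun N => leg₁ (M N)) = legL (matOfSeries (opSeries M)) := by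
  ext ⟨i, k⟩ ⟨j, l⟩ N
  simp only [coeff_matOfSeries, opSeries₂, PowerSeries.coeff_mk, evenOp₂_leg₁, legL]
  by_cases h : k = l
  · rcases i <;> rcases j <;> rcases k <;> simp [par, h, coeff_matOfSeries, opSeries]
  · simp [h]

theorem matOfSeries_opSeries₂_leg₂ (M : ℕ → Idx m n → Idx m n → A) :
    matOfSeries (opSeries₂ fun N => leg₂ (M N)) = legR (matOfSeries (opSeries M)) := by
  ext a b N
  simp only [coeff_matOfSeries, opSeries₂, PowerSeries.coeff_mk, evenOp₂_leg₂, legR]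
  split_ifs <;> simp [coeff_matOfSeries, opSeries]

theorem matOfSeries_opSeries_transp (S : PowerSeries (Matrix (Idx m n) (Idx m n) A)) :
    matOfSeries (opSeries fun N => transp (evenCoef (PowerSeries.coeff N S))) =
      superT (matOfSeries S) := by
  ext i j N
  simp only [coeff_matOfSeries, opSeries, PowerSeries.coeff_mk, evenOp_transp_evenCoef, superT]
  rcases i <;> rcases j <;> simp [par, coeff_matOfSeries]

/-- Every row of P^{τ₂} indexed by a pair (i, i) sums over the pairs (p, p). Contracting X₁(S^τ)₂ in
this way gives, up to a sign depending on the column, the entries of X^τ S^τ. -/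
theorem isContraction_of_superT_mul {M L : ℕ → Idx m n → Idx m n → A} {z : ℕ → A}
    {S : PowerSeries (Matrix (Idx m n) (Idx m n) A)}
    (h₁ : opSeries L * S = 1) (h₂ : S * opSeries L = 1)
    (h : superT (matOfSeries (opSeries M)) * superT (matOfSeries S) =
      Matrix.diagonal fun _ => PowerSeries.mk z) : IsContraction M L z := by
  refine ⟨S, h₁, h₂, matOfSeries_injective ?_⟩
  rw [map_mul, map_mul, matOfSeries_opSeries₂_leg₁, matOfSeries_opSeries₂_leg₂,
    matOfSeries_opSeries_transp, mul_assoc]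
  set X := matOfSeries (opSeries M)
  have hC : (matOfSeries (PowerSeries.C (evenOp₂ (transp₂ permP))) :
      Matrix (Idx₂ m n) (Idx₂ m n) (PowerSeries A)) = evenOp₂ (transp₂ permP) := by
    ext a ⟨j, l⟩ N
    rw [coeff_matOfSeries, evenOp₂_transp₂_permP]
    rcases eq_or_ne j l with rfl | h'
    · by_cases h : a.1 = a.2 <;> rcases N with _ | N <;> rcases j <;>
        simp [evenOp₂_transp₂_permP, par, h, PowerSeries.coeff_C, PowerSeries.coeff_one]
    · rcases N with _ | N <;> simp [evenOp₂_transp₂_permP, h', PowerSeries.coeff_C]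
  rw [hC]
  have key : ∀ j l : Idx m n, ∑ p, (-1) ^ par p * (legL X * legR (superT (matOfSeries S))) (p, p)
      (j, l) = (-1) ^ par j * (superT X * superT (matOfSeries S)) j l := by
    intro j l
    rw [Matrix.mul_apply, Finset.mul_sum]
    refine Finset.sum_congr rfl fun p _ => ?_
    rw [mul_legR_apply]
    simp only [legL, superT]
    rcases j <;> rcases p <;> simp [par]
  ext ⟨i, k⟩ ⟨j, l⟩ N
  have : (evenOp₂ (transp₂ permP) * (legL X * legR (superT (matOfSeries S))) :
      Matrix (Idx₂ m n) (Idx₂ m n) (PowerSeries A)) (i, k) (j, l) =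
      if i = k then (-1) ^ par j * Matrix.diagonal (fun _ => PowerSeries.mk z) j l else 0 := by
    rw [← h, ← key]
    by_cases h : i = k <;>
      simp [Matrix.mul_apply, evenOp₂_transp₂_permP, Fintype.sum_prod_type, h]
  rw [this, coeff_matOfSeries, opSeries₂, PowerSeries.coeff_mk, evenOp₂_transp₂_permP_mul]
  by_cases h : i = k <;> by_cases h' : j = l <;> rcases j <;> simp [h, h', par]

/-- The inverse series is unique, and P^{τ₂} has entries ±1 from which z can be read off; m ≠ n
guarantees that there is at least one index. -/
theorem IsContraction.unique (hmn : m ≠ n) {M L : ℕ → Idx m n → Idx m n → A} {z w : ℕ → A}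
    (hz : IsContraction M L z) (hw : IsContraction M L w) : w = z := by
  obtain ⟨i⟩ : Nonempty (Idx m n) := by
    rcases Nat.eq_zero_or_pos m with h | h
    · exact ⟨Sum.inr ⟨0, by omega⟩⟩
    · exact ⟨Sum.inl ⟨0, h⟩⟩
  obtain ⟨S, hS₁, hS₂, hS⟩ := hz
  obtain ⟨S', hS'₁, hS'₂, hS'⟩ := hw
  obtain rfl : S = S' := left_inv_eq_right_inv hS₂ hS'₁
  funext N
  have h := PowerSeries.ext_iff.mp (hS'.symm.trans hS) N
  rw [opSeries₂, opSeries₂, PowerSeries.coeff_mk, PowerSeries.coeff_mk] at h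
  have := congrFun (congrFun h (i, i)) (i, i)
  rw [evenOp₂_transp₂_permP_mul, evenOp₂_transp₂_permP_mul] at this
  rcases i <;> simpa [par] using this

end Contraction

/-! ### Passing from the free algebra to the completed double Yangian -/

section Completion

variable (m n : ℕ)

/-- The projection from the free algebra to the double Yangian. -/
def dyHom : FreeAlgebra ℂ (Gen m n) →ₐ[ℂ] DY m n := RingQuot.mkAlgHom ℂ (Rel m n)

/-- The homomorphism from the free algebra to the completed double Yangian. -/
def compHom : FreeAlgebra ℂ (Gen m n) →ₐ[ℂ] Comp m n where
  toRingHom := (UniformSpace.Completion.coeRingHom (α := DY m n)).comp (dyHom m n).toRingHom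
  commutes' r := by
    rw [UniformSpace.Completion.algebraMap_def, ← (dyHom m n).commutes r]
    rfl

variable {m n}

theorem compHom_eq (x : FreeAlgebra ℂ (Gen m n)) :
    compHom m n x = ((dyHom m n x : DY m n) : Comp m n) := rfl

theorem compHom_ι (a : Gen m n) : compHom m n (FreeAlgebra.ι ℂ a) = cgen a := rfl

theorem compHom_eq_of_rel {x y : FreeAlgebra ℂ (Gen m n)} (h : Rel m n x y) :
    compHom m n x = compHom m n y := by
  rw [compHom_eq, compHom_eq]
  exact congrArg _ (RingQuot.mkAlgHom_rel ℂ h)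

/-- The centralizer of z is closed, and the generators generate a dense subalgebra. -/
theorem commute_of_commute_cgen {z : Comp m n} (h : ∀ a, Commute z (cgen a)) (w : Comp m n) :
    Commute z w := by
  have hc : IsClosed {w : Comp m n | z * w = w * z} :=
    isClosed_eq (continuous_const_mul z) (continuous_mul_const z)
  refine UniformSpace.Completion.induction_on (p := fun w => z * w = w * z) w hc fun x => ?_
  obtain ⟨a, rfl⟩ : ∃ a, dyHom m n a = x := RingQuot.mkAlgHom_surjective ℂ (Rel m n) x
  change z * compHom m n a = compHom m n a * z
  induction a using FreeAlgebra.induction with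
  | grade0 r => rw [AlgHom.commutes]; exact (Algebra.commutes r z).symm
  | grade1 a => exact h a
  | mul a b ha hb => rw [map_mul]; exact Commute.mul_right ha hb
  | add a b ha hb => rw [map_add]; exact Commute.add_right ha hb

theorem commute_cgen_C (w : Comp m n) : Commute (cgen Gen.C) w := by
  refine commute_of_commute_cgen (fun a => ?_) w
  have := compHom_eq_of_rel (Rel.central a)
  rw [map_mul, map_mul] at this
  exact this

end Completion

/-! ### The relations as matrix identities over two-variable series -/

section Series

variable (m n : ℕ)

/-- Series in an outer and an inner variable over the completed double Yangian. -/
abbrev CompSeries : Type := PowerSeries (PowerSeries (Comp m n))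

/-- Series in an outer and an inner variable over `ℂ[C]`. -/
abbrev ScalarSeries : Type := PowerSeries (PowerSeries (Polynomial ℂ))

/-- Evaluation of the coefficients of a series over `ℂ[C]`. -/
def scalarHom₁ : PowerSeries (Polynomial ℂ) →+* PowerSeries (Comp m n) :=
  PowerSeries.map (Polynomial.aeval (cgen Gen.C : Comp m n)).toRingHom

/-- Evaluation of the coefficients of a series over `ℂ[C]`. -/
def scalarHom : ScalarSeries →+* CompSeries m n := PowerSeries.map (scalarHom₁ m n)

variable {m n}

theorem commute_aeval (p : Polynomial ℂ) (w : Comp m n) :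
    Commute (Polynomial.aeval (cgen Gen.C : Comp m n) p) w := by
  induction p using Polynomial.induction_on' with
  | add p q hp hq => rw [map_add]; exact hp.add_left hq
  | monomial k a =>
    rw [Polynomial.aeval_monomial]
    exact Commute.mul_left (Algebra.commutes a w) ((commute_cgen_C w).pow_left k)

theorem powerSeries_commute {R : Type*} [Semiring R] {f g : PowerSeries R}
    (h : ∀ i j, Commute (PowerSeries.coeff i f) (PowerSeries.coeff j g)) : Commute f g := by
  ext N
  rw [PowerSeries.coeff_mul, PowerSeries.coeff_mul, ← Finset.Nat.sum_antidiagonal_swap]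
  exact Finset.sum_congr rfl fun x _ => (h _ _).eq

theorem commute_scalarHom₁ (p : PowerSeries (Polynomial ℂ)) (w : PowerSeries (Comp m n)) :
    Commute (scalarHom₁ m n p) w :=
  powerSeries_commute fun i j => by
    rw [scalarHom₁, PowerSeries.coeff_map]
    exact commute_aeval _ _

theorem commute_scalarHom (p : ScalarSeries) (w : CompSeries m n) :
    Commute (scalarHom m n p) w :=
  powerSeries_commute fun i j => by
    rw [scalarHom, PowerSeries.coeff_map]
    exact commute_scalarHom₁ _ _

/-- Centrality of C puts the coefficients of all R-matrices in the commutative ring ℂ[C][[y]][[x]],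
where crossing symmetry becomes polynomial algebra. -/
instance : Algebra ScalarSeries (CompSeries m n) :=
  (scalarHom m n).toAlgebra' fun p w => commute_scalarHom p w

theorem scalar_smul_def (p : ScalarSeries) (w : CompSeries m n) : p • w = scalarHom m n p * w := rfl

variable (m n)

/-- The evaluation of series over the free algebra as matrices over `CompSeries`. -/
def innerEval : PowerSeries (Matrix (Idx₂ m n) (Idx₂ m n) (FreeAlgebra ℂ (Gen m n))) →+*
    Matrix (Idx₂ m n) (Idx₂ m n) (PowerSeries (Comp m n)) :=
  matOfSeries.comp (PowerSeries.map (compHom m n).toRingHom.mapMatrix)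

/-- The evaluation of series over the free algebra as matrices over `CompSeries`. -/
def biEval : BiSeries m n →+* Matrix (Idx₂ m n) (Idx₂ m n) (CompSeries m n) :=
  matOfSeries.comp (PowerSeries.map (innerEval m n))

variable {m n}

theorem coeff_biEval (F : BiSeries m n) (p q : Idx₂ m n) (a : ℕ) :
    PowerSeries.coeff a (biEval m n F p q) = innerEval m n (PowerSeries.coeff a F) p q := by
  rw [biEval, RingHom.comp_apply, coeff_matOfSeries, PowerSeries.coeff_map]

theorem coeff_innerEval (F : PowerSeries (Matrix (Idx₂ m n) (Idx₂ m n) (FreeAlgebra ℂ (Gen m n))))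
    (p q : Idx₂ m n) (b : ℕ) : PowerSeries.coeff b (innerEval m n F p q) =
      compHom m n (PowerSeries.coeff b F p q) := by
  rw [innerEval, RingHom.comp_apply, coeff_matOfSeries, PowerSeries.coeff_map]
  rfl

/-- Converts the coefficientwise and entrywise relations back into identities of matrices of series.
-/
theorem biEval_eq_of_rel {F G : BiSeries m n}
    (h : ∀ a b p q, Rel m n (PowerSeries.coeff b (PowerSeries.coeff a F) p q)
      (PowerSeries.coeff b (PowerSeries.coeff a G) p q)) : biEval m n F = biEval m n G := by
  ext p q a b
  rw [coeff_biEval, coeff_biEval, coeff_innerEval, coeff_innerEval]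
  exact compHom_eq_of_rel (h a b p q)

/-- A series as a series in the outer variable. -/
def inX : PowerSeries (Comp m n) →+* CompSeries m n := PowerSeries.map PowerSeries.C

/-- A series as a series in the inner variable. -/
def inY : PowerSeries (Comp m n) →+* CompSeries m n := PowerSeries.C

/-- The outer variable. -/
def xS : ScalarSeries := PowerSeries.X

/-- The inner variable. -/
def yS : ScalarSeries := PowerSeries.C PowerSeries.X

/-- The matrix of series with the given coefficients. -/
def serMat (M : ℕ → Idx m n → Idx m n → Comp m n) :
    Matrix (Idx m n) (Idx m n) (PowerSeries (Comp m n)) := matOfSeries (opSeries M)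

theorem coeff_serMat (M : ℕ → Idx m n → Idx m n → Comp m n) (i j : Idx m n) (N : ℕ) :
    PowerSeries.coeff N (serMat M i j) = evenOp (M N) i j := by
  rw [serMat, coeff_matOfSeries, opSeries, PowerSeries.coeff_mk]

theorem innerEval_C (M : Matrix (Idx₂ m n) (Idx₂ m n) (FreeAlgebra ℂ (Gen m n))) :
    innerEval m n (PowerSeries.C M) = (M.map (compHom m n)).map PowerSeries.C := by
  ext p q N
  rw [coeff_innerEval]
  rcases N with _ | N <;> simp [PowerSeries.coeff_C]

theorem evenOp₂_leg₁_map (f : Idx m n → Idx m n → FreeAlgebra ℂ (Gen m n)) :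
    (evenOp₂ (leg₁ f)).map (compHom m n) = legL (evenOp fun i j => compHom m n (f i j)) := by
  rw [← evenOp₂_leg₁]
  ext a b
  simp only [evenOp₂, Matrix.map_apply, leg₁, map_mul, map_pow, map_neg, map_one]
  split_ifs <;> simp

theorem evenOp₂_leg₂_map (f : Idx m n → Idx m n → FreeAlgebra ℂ (Gen m n)) :
    (evenOp₂ (leg₂ f)).map (compHom m n) = legR (evenOp fun i j => compHom m n (f i j)) := by
  rw [← evenOp₂_leg₂]
  ext a b
  simp only [evenOp₂, Matrix.map_apply, leg₂, map_mul, map_pow, map_neg, map_one]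
  split_ifs <;> simp

theorem biEval_outer (f : ℕ → Idx m n → Idx m n → FreeAlgebra ℂ (Gen m n)) :
    biEval m n (outer fun r => evenOp₂ (leg₁ (f r))) =
      legL ((serMat fun r i j => compHom m n (f r i j)).map inX) := by
  ext ⟨i, k⟩ ⟨j, l⟩ a : 3
  rw [coeff_biEval, outer, PowerSeries.coeff_mk, innerEval_C, evenOp₂_leg₁_map]
  simp only [Matrix.map_apply, legL]
  by_cases h : k = l
  · rcases i <;> rcases j <;> rcases k <;> simp [h, inX, coeff_serMat, par]
  · simp [h]

theorem biEval_inner (f : ℕ → Idx m n → Idx m n → FreeAlgebra ℂ (Gen m n)) :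
    biEval m n (inner fun r => evenOp₂ (leg₂ (f r))) =
      legR ((serMat fun r i j => compHom m n (f r i j)).map inY) := by
  ext p q a b
  rw [coeff_biEval, inner, PowerSeries.coeff_C]
  simp only [Matrix.map_apply, legR, inY]
  rcases a with _ | a
  · rw [if_pos rfl, coeff_innerEval, PowerSeries.coeff_mk]
    have := congrFun (congrFun (evenOp₂_leg₂_map (f b)) p) q
    rw [Matrix.map_apply] at this
    rw [this, legR]
    split_ifs <;> simp [coeff_serMat]
  · rw [if_neg a.succ_ne_zero]
    split_ifs <;> simp

theorem compHom_freeT (r : ℕ) (i j : Idx m n) : compHom m n (freeT m n r i j) = T m n r i j := by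
  rcases r with _ | r
  · by_cases h : i = j <;> simp [freeT, T, tCoef, h]
  · simp [freeT, T, tCoef, compHom_ι]

theorem compHom_freeTPlus (r : ℕ) (i j : Idx m n) :
    compHom m n (freeTPlus m n r i j) = TPlus m n r i j := by
  by_cases h : r = 0 ∧ i = j <;> simp [freeTPlus, TPlus, tPlusCoef, compHom_ι, h]

theorem biEval_xv : biEval m n (xv m n) = xS • (1 : Matrix (Idx₂ m n) (Idx₂ m n) (CompSeries m n)) := by
  ext p q a b
  rw [coeff_biEval, coeff_innerEval, Matrix.smul_apply, scalar_smul_def]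
  by_cases h : p = q <;> by_cases h' : a = 1 <;> by_cases h'' : b = 0 <;>
    simp [xv, xS, scalarHom, PowerSeries.coeff_X, Matrix.one_apply, PowerSeries.coeff_one, *]

theorem biEval_yv : biEval m n (yv m n) = yS • (1 : Matrix (Idx₂ m n) (Idx₂ m n) (CompSeries m n)) := by
  ext p q a b
  rw [coeff_biEval, coeff_innerEval, Matrix.smul_apply, scalar_smul_def]
  by_cases h : p = q <;> by_cases h' : a = 0 <;> by_cases h'' : b = 1 <;>
    simp [yv, yS, scalarHom, scalarHom₁, PowerSeries.coeff_X, PowerSeries.coeff_C, Matrix.one_apply, *]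

theorem biEval_Pc : biEval m n (Pc m n) = flipM := by
  ext ⟨i, k⟩ ⟨j, l⟩ a b
  rw [coeff_biEval, coeff_innerEval, Pc, evenOp₂_permP]
  by_cases h : i = l ∧ k = j
  · obtain ⟨rfl, rfl⟩ := h
    rcases i <;> rcases k <;> rcases a with _ | a <;> rcases b with _ | b <;>
      simp [PowerSeries.coeff_C, PowerSeries.coeff_one, flipM, par]
  · rcases a with _ | a <;> rcases b with _ | b <;> simp [PowerSeries.coeff_C, flipM, h]

theorem exchange_T :
    rOp (yS - xS) (-(xS * yS)) * (legL ((serMat (T m n)).map inX) * legR ((serMat (T m n)).map inY)) =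
      legR ((serMat (T m n)).map inY) * legL ((serMat (T m n)).map inX) *
        rOp (yS - xS) (-(xS * yS)) := by
  have h := biEval_eq_of_rel (m := m) (n := n) Rel.rtt
  have hR : biEval m n (yv m n - xv m n - xv m n * yv m n * Pc m n) =
      rOp (yS - xS) (-(xS * yS)) := by
    rw [map_sub, map_sub, map_mul, map_mul, biEval_xv, biEval_yv, biEval_Pc, rOp]
    rw [smul_mul_smul_comm, mul_one, smul_mul_assoc, one_mul, neg_smul, sub_smul, ← sub_eq_add_neg]
  have hT : (fun r i j => compHom m n (freeT m n r i j)) = T m n := by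
    funext r i j
    exact compHom_freeT r i j
  rw [map_mul, map_mul, map_mul, map_mul, hR, biEval_outer, biEval_inner, hT, mul_assoc] at h
  exact h

theorem exchange_TPlus :
    rOp (xS - yS) (-1) * (legL ((serMat (TPlus m n)).map inX) *
        legR ((serMat (TPlus m n)).map inY)) =
      legR ((serMat (TPlus m n)).map inY) * legL ((serMat (TPlus m n)).map inX) *
        rOp (xS - yS) (-1) := by
  have h := biEval_eq_of_rel (m := m) (n := n) Rel.rttPlus
  have hR : biEval m n (xv m n - yv m n - Pc m n) = rOp (xS - yS) (-1) := by
    rw [map_sub, map_sub, biEval_xv, biEval_yv, biEval_Pc, rOp, neg_smul, sub_smul, one_smul,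
      ← sub_eq_add_neg]
  have hT : (fun r i j => compHom m n (freeTPlus m n r i j)) = TPlus m n := by
    funext r i j
    exact compHom_freeTPlus r i j
  rw [map_mul, map_mul, map_mul, map_mul, hR, biEval_outer, biEval_inner, hT, mul_assoc] at h
  exact h

end Series

/-! ### The normalized R-matrix and its functional equation -/

section Scalars

variable (m n : ℕ)

/-- The scalar `m - n`. -/
def sdim : ℂ := (m : ℂ) - n

/-- A complex number as a constant series over `ℂ[C]`. -/
def cS : ℂ →+* PowerSeries (Polynomial ℂ) := PowerSeries.C.comp Polynomial.C

/-- The normalizing series `g(u)`. -/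
def gS : ScalarSeries := PowerSeries.map cS (PowerSeries.mk (gCoef (sdim m n)))

/-- `g(u + e)`. -/
def gShift (e : PowerSeries (Polynomial ℂ)) : ScalarSeries :=
  shiftHom e (Commute.all e) (gS m n)

/-- `(u + e)⁻¹`. -/
def invShift (e : PowerSeries (Polynomial ℂ)) : ScalarSeries :=
  shiftHom e (Commute.all e) PowerSeries.X

/-- `- v + ε C`. -/
def shiftParam (ε : ℂ) : PowerSeries (Polynomial ℂ) :=
  -PowerSeries.X + PowerSeries.C (Polynomial.C ε * Polynomial.X)

variable {m n}

theorem shiftHom_gS (hmn : m ≠ n) :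
    shiftHom (cS (sdim m n)) (Commute.all _) (gS m n) = (1 - xS ^ 2) * gS m n := by
  have h := gCoef_functional (sdim m n) (sub_ne_zero.mpr (by exact_mod_cast hmn))
  have h' := congrArg (PowerSeries.map cS) h
  rw [map_mul, map_sub, map_pow, map_one, PowerSeries.map_X] at h'
  rw [gS, xS, ← h', ← shiftHom_map cS _ (Commute.all _)]
  congr 1
  ext N
  simp [coeff_shiftHom]

theorem gShift_add (hmn : m ≠ n) (e : PowerSeries (Polynomial ℂ)) :
    gShift m n (e + cS (sdim m n)) = (1 - invShift e ^ 2) * gShift m n e := by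
  rw [gShift, ← shiftHom_comp e (cS (sdim m n)) _ (Commute.all _) (Commute.all _) (Commute.all _)
    rfl, shiftHom_gS hmn, map_mul, map_sub, map_pow, map_one]
  rfl

theorem invShift_add (e : PowerSeries (Polynomial ℂ)) (c : ℂ) :
    invShift (e + cS c) * (1 + PowerSeries.C (cS c) * invShift e) = invShift e := by
  have h := congrArg (shiftHom e (Commute.all e)) (shiftHom_X (cS c) (Commute.all _))
  rw [map_mul, shiftHom_comp e (cS c) (e + cS c) _ _ (Commute.all _) rfl, map_add, map_one,
    map_mul, shiftHom_C] at h
  exact h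

/-- The flip P is not central in the matrix ring, so `shiftHom` does not apply there directly. It
does commute with the shift parameter, which is enough to pull it out of the sum. -/
theorem shiftSeries_linear {R R' : Type*} [Ring R] [Ring R'] (φ : R →+* R') (d : R) (f g : ℕ → R)
    (P : R') (hP : Commute P (φ d)) (N : ℕ) :
    shiftSeries (φ d) (fun r => φ (f r) - φ (g r) * P) N =
      φ (shiftSeries d f N) - φ (shiftSeries d g N) * P := by
  rw [shiftSeries_map, shiftSeries_map, shiftSeries, shiftSeries, shiftSeries, Finset.sum_mul,
    ← Finset.sum_sub_distrib]
  refine Finset.sum_congr rfl fun r _ => ?_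
  rw [sub_mul, smul_sub, mul_assoc, (hP.pow_right _).eq, ← mul_assoc, smul_mul_assoc]

theorem innerEval_param (ε : ℂ) :
    innerEval m n (-PowerSeries.X + PowerSeries.C (ε • Matrix.scalar _ (FreeAlgebra.ι ℂ Gen.C))) =
      Matrix.scalar _ (scalarHom₁ m n (shiftParam ε)) := by
  ext p q b
  rw [coeff_innerEval]
  by_cases h : p = q <;> rcases b with _ | _ | b <;>
    simp [scalarHom₁, shiftParam, PowerSeries.coeff_X, h, compHom_ι, ← Algebra.smul_def]

theorem map_flipM {R R' : Type*} [Ring R] [Ring R'] (f : R →+* R') (p q : Idx₂ m n) :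
    f (flipM p q) = flipM p q := by
  simp only [flipM]
  split_ifs <;> simp

theorem map_one_apply {R R' J : Type*} [DecidableEq J] [Ring R] [Ring R'] (f : R →+* R')
    (p q : J) : f ((1 : Matrix J J R) p q) = (1 : Matrix J J R') p q := by
  simp only [Matrix.one_apply]
  split_ifs <;> simp

/-- The factor X in front of the second g is the u⁻¹ in g(u)(1 - Pu⁻¹). -/
theorem innerEval_rBarCoef (r : ℕ) :
    innerEval m n (PowerSeries.C (rBarCoef m n r)) =
      Matrix.scalar _ (scalarHom₁ m n (PowerSeries.coeff r (gS m n))) -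
        Matrix.scalar _ (scalarHom₁ m n (PowerSeries.coeff r (PowerSeries.X * gS m n))) *
          flipM := by
  rw [innerEval_C]
  ext p q b
  have hg : ∀ k, PowerSeries.coeff k (gS m n) = cS (gCoef (sdim m n) k) := fun k => by
    rw [gS, PowerSeries.coeff_map, PowerSeries.coeff_mk]
  have hs : ∀ z : ℂ, scalarHom₁ m n (cS z) = PowerSeries.C (algebraMap ℂ (Comp m n) z) := fun z => by
    simp [scalarHom₁, cS]
  have h1 := map_one_apply (compHom m n).toRingHom p q
  have h2 := map_flipM (compHom m n).toRingHom p q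
  simp only [AlgHom.toRingHom_eq_coe, RingHom.coe_coe] at h1 h2
  have hd : ∀ z : Comp m n, (Matrix.diagonal (fun _ => PowerSeries.C z) : Matrix (Idx₂ m n) _ _) p q =
      PowerSeries.C (z * (1 : Matrix (Idx₂ m n) (Idx₂ m n) (Comp m n)) p q) := by
    intro z
    by_cases h : p = q <;> simp [Matrix.one_apply, h]
  rw [Matrix.map_apply, Matrix.map_apply, Matrix.sub_apply, Matrix.scalar_apply,
    Matrix.scalar_apply, Matrix.diagonal_mul, ← map_flipM PowerSeries.C, hg, hs, hd]
  rcases r with _ | r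
  · simp [rBarCoef, h1, sdim, Algebra.smul_def]
  · have hm : ∀ (z : ℂ) (w : Comp m n), PowerSeries.C (algebraMap ℂ (Comp m n) z) *
        (PowerSeries.C w) = PowerSeries.C (z • w) := fun z w => by
      rw [← map_mul, ← Algebra.smul_def]
    rw [PowerSeries.coeff_succ_X_mul, hg, hs, hm, ← Algebra.smul_def, ← map_sub]
    simp [rBarCoef, h1, h2, evenOp₂_permP, sdim]

theorem biEval_rBar (ε : ℂ) : biEval m n (rBar m n ε) =
    rOp (gShift m n (shiftParam ε)) (-(invShift (shiftParam ε) * gShift m n (shiftParam ε))) := by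
  have hc : ∀ x : PowerSeries (Comp m n), Commute (flipM : Matrix (Idx₂ m n) (Idx₂ m n) _)
      (Matrix.scalar _ x) := by
    intro x
    ext p q : 1
    simp only [Matrix.scalar_apply, Matrix.mul_diagonal, Matrix.diagonal_mul, flipM]
    split_ifs
    · exact ((Commute.neg_one_left x).pow_left _).eq
    · simp
  ext p q N : 2
  rw [coeff_biEval, rBar, PowerSeries.coeff_mk, shiftSeries_map, innerEval_param]
  simp only [innerEval_rBarCoef]
  have := shiftSeries_linear ((Matrix.scalar (Idx₂ m n)).comp (scalarHom₁ m n)) (shiftParam ε)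
    (fun r => PowerSeries.coeff r (gS m n)) (fun r => PowerSeries.coeff r (PowerSeries.X * gS m n))
    flipM (hc _) N
  simp only [RingHom.comp_apply] at this
  rw [this, ← coeff_shiftHom _ (Commute.all _), ← coeff_shiftHom _ (Commute.all _), map_mul]
  simp only [rOp, Matrix.add_apply, Matrix.sub_apply, Matrix.smul_apply, scalar_smul_def, map_add]
  rw [← map_flipM PowerSeries.C, ← map_one_apply PowerSeries.C, PowerSeries.coeff_mul_C,
    PowerSeries.coeff_mul_C, Matrix.scalar_apply, Matrix.scalar_apply, Matrix.diagonal_mul,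
    scalarHom, PowerSeries.coeff_map, PowerSeries.coeff_map, map_neg, map_neg, neg_mul,
    ← sub_eq_add_neg]
  congr 1
  by_cases h : p = q
  · subst h
    simp [gShift]
  · simp [h]

theorem exchange_mixed :
    rOp (gShift m n (shiftParam (1 / 2)))
        (-(invShift (shiftParam (1 / 2)) * gShift m n (shiftParam (1 / 2)))) *
      (legL ((serMat (T m n)).map inX) * legR ((serMat (TPlus m n)).map inY)) =
      legR ((serMat (TPlus m n)).map inY) * legL ((serMat (T m n)).map inX) *
        rOp (gShift m n (shiftParam (-(1 / 2))))
          (-(invShift (shiftParam (-(1 / 2))) * gShift m n (shiftParam (-(1 / 2))))) := by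
  have h := biEval_eq_of_rel (m := m) (n := n) Rel.rttMixed
  have hT : (fun r i j => compHom m n (freeT m n r i j)) = T m n := by
    funext r i j
    exact compHom_freeT r i j
  have hT' : (fun r i j => compHom m n (freeTPlus m n r i j)) = TPlus m n := by
    funext r i j
    exact compHom_freeTPlus r i j
  rw [map_mul, map_mul, map_mul, map_mul, biEval_rBar, biEval_rBar, biEval_outer, biEval_inner,
    hT, hT', mul_assoc] at h
  exact h

end Scalars

/-! ### Functoriality, and cancellation by regular constant terms -/

section MapLemmas

variable {m n : ℕ} {R R' : Type*} [Ring R] [Ring R']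

theorem map_legL (f : R →+* R') (X : Matrix (Idx m n) (Idx m n) R) :
    (legL X).map f = legL (X.map f) := by
  ext a b
  simp only [legL, Matrix.map_apply]
  split_ifs <;> simp

theorem map_legR (f : R →+* R') (X : Matrix (Idx m n) (Idx m n) R) :
    (legR X).map f = legR (X.map f) := by
  ext a b
  simp only [legR, Matrix.map_apply]
  split_ifs <;> simp

theorem map_superT (f : R →+* R') (X : Matrix (Idx m n) (Idx m n) R) :
    (superT X).map f = superT (X.map f) := by
  ext i j
  simp [superT]

theorem map_rOp {Z Z' : Type*} [CommRing Z] [Algebra Z R] [CommRing Z'] [Algebra Z' R']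
    (f : R →+* R') (θ : Z → Z') (hf : ∀ z, f (algebraMap Z R z) = algebraMap Z' R' (θ z)) (α β : Z) :
    (rOp α β : Matrix (Idx₂ m n) (Idx₂ m n) R).map f = rOp (θ α) (θ β) := by
  ext a b
  simp only [rOp, Matrix.map_apply, Matrix.add_apply, Matrix.smul_apply]
  simp only [Algebra.smul_def, map_add, map_mul, hf, map_one_apply, map_flipM]

theorem exchange_smul {Z : Type*} [CommRing Z] [Algebra Z R]
    {X Y : Matrix (Idx m n) (Idx m n) R} {αa βa αb βb : Z} (z : Z)
    (h : rOp αa βa * (legL X * legR Y) = legR Y * legL X * rOp αb βb) :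
    rOp (z * αa) (z * βa) * (legL X * legR Y) = legR Y * legL X * rOp (z * αb) (z * βb) := by
  have hs : ∀ α β : Z, (rOp (z * α) (z * β) : Matrix (Idx₂ m n) (Idx₂ m n) R) = z • rOp α β := by
    intro α β
    simp [rOp, mul_smul]
  rw [hs, hs, smul_mul_assoc, mul_smul_comm, h]

theorem eq_zero_of_constantCoeff_mul {f e : PowerSeries R}
    (hf : ∀ a, PowerSeries.constantCoeff f * a = 0 → a = 0) (h : f * e = 0) : e = 0 := by
  ext N
  rw [map_zero]
  induction N using Nat.strong_induction_on with
  | _ N ih =>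
    apply hf
    have := congrArg (PowerSeries.coeff N) h
    rw [map_zero, PowerSeries.coeff_mul, Finset.sum_eq_single (0, N)] at this
    · simpa using this
    · intro x hx hne
      have hx' := Finset.HasAntidiagonal.mem_antidiagonal.mp hx
      rw [ih x.2, mul_zero]
      rcases x with ⟨i, j⟩
      simp only [ne_eq, Prod.mk.injEq, not_and] at hne hx' ⊢
      rcases Nat.eq_zero_or_pos i with h0 | h0
      · exact absurd (by omega) (hne h0)
      · omega
    · simp

end MapLemmas

/-! ### Setting the two spectral parameters equal -/

section Diagonal

variable {m n : ℕ}

/-- The restriction of a series in two variables to the diagonal. -/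
def diagRestrict : CompSeries m n →+ PowerSeries (Comp m n) where
  toFun F := PowerSeries.mk fun N =>
    ∑ x ∈ Finset.HasAntidiagonal.antidiagonal N, PowerSeries.coeff x.2 (PowerSeries.coeff x.1 F)
  map_zero' := by ext; simp
  map_add' F G := by ext; simp [Finset.sum_add_distrib]

theorem coeff_diagRestrict (F : CompSeries m n) (N : ℕ) :
    PowerSeries.coeff N (diagRestrict F) = ∑ x ∈ Finset.HasAntidiagonal.antidiagonal N,
      PowerSeries.coeff x.2 (PowerSeries.coeff x.1 F) := by
  simp [diagRestrict]

/-- Restriction to the diagonal is not multiplicative, since the coefficients do not commute. It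
respects products in which all factors in one variable precede those in the other. -/
theorem diagRestrict_inX_mul_inY (f g : PowerSeries (Comp m n)) :
    diagRestrict (inX f * inY g) = f * g := by
  ext N
  rw [coeff_diagRestrict, PowerSeries.coeff_mul]
  refine Finset.sum_congr rfl fun x _ => ?_
  rw [inX, inY, PowerSeries.coeff_mul_C, PowerSeries.coeff_map, PowerSeries.coeff_C_mul]

theorem diagRestrict_inY_mul_inX (f g : PowerSeries (Comp m n)) :
    diagRestrict (inY g * inX f) = g * f := by
  ext N
  rw [coeff_diagRestrict, PowerSeries.coeff_mul, ← Finset.Nat.sum_antidiagonal_swap]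
  refine Finset.sum_congr rfl fun x _ => ?_
  rw [inX, inY, PowerSeries.coeff_C_mul, PowerSeries.coeff_map, PowerSeries.coeff_mul_C]
  rfl

theorem scalarHom_xS : scalarHom m n xS = PowerSeries.X := by simp [scalarHom, xS]

theorem scalarHom_yS : scalarHom m n yS = PowerSeries.C PowerSeries.X := by
  simp [scalarHom, scalarHom₁, yS]

theorem diagRestrict_xS_smul (F : CompSeries m n) :
    diagRestrict (xS • F) = PowerSeries.X * diagRestrict F := by
  ext N
  rw [coeff_diagRestrict, scalar_smul_def, scalarHom_xS]
  rcases N with _ | N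
  · simp
  · rw [Finset.Nat.sum_antidiagonal_succ, PowerSeries.coeff_succ_X_mul, coeff_diagRestrict]
    simp

theorem diagRestrict_yS_smul (F : CompSeries m n) :
    diagRestrict (yS • F) = PowerSeries.X * diagRestrict F := by
  ext N
  rw [coeff_diagRestrict, scalar_smul_def, scalarHom_yS]
  rcases N with _ | N
  · simp
  · rw [Finset.Nat.sum_antidiagonal_succ', PowerSeries.coeff_succ_X_mul, coeff_diagRestrict]
    simp [PowerSeries.coeff_C_mul]

theorem scalarHom₁_cS (z : ℂ) :
    scalarHom₁ m n (cS z) = PowerSeries.C (algebraMap ℂ (Comp m n) z) := by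
  simp [scalarHom₁, cS]

theorem diagRestrict_cS_smul (z : ℂ) (F : CompSeries m n) :
    diagRestrict ((PowerSeries.C (cS z) : ScalarSeries) • F) = z • diagRestrict F := by
  ext N
  rw [coeff_diagRestrict, scalar_smul_def, scalarHom, PowerSeries.map_C, scalarHom₁_cS,
    Algebra.smul_def, PowerSeries.algebraMap_apply, PowerSeries.coeff_C_mul, coeff_diagRestrict,
    Finset.mul_sum]
  refine Finset.sum_congr rfl fun x _ => ?_
  rw [PowerSeries.coeff_C_mul, PowerSeries.coeff_C_mul]

theorem diagRestrict_map_mul_map (M K : Matrix (Idx₂ m n) (Idx₂ m n) (PowerSeries (Comp m n)))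
    (a b : Idx₂ m n) : diagRestrict ((M.map inX * K.map inY) a b) = (M * K) a b := by
  simp [Matrix.mul_apply, diagRestrict_inX_mul_inY]

theorem diagRestrict_map_mul_map' (M K : Matrix (Idx₂ m n) (Idx₂ m n) (PowerSeries (Comp m n)))
    (a b : Idx₂ m n) : diagRestrict ((M.map inY * K.map inX) a b) = (M * K) a b := by
  simp [Matrix.mul_apply, diagRestrict_inY_mul_inX]

theorem map_flip {R R' : Type*} [Ring R] [Ring R'] (f : R →+* R') :
    (flipM : Matrix (Idx₂ m n) (Idx₂ m n) R).map f = flipM := by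
  ext a b
  exact map_flipM f a b

/-- The residue of an exchange relation at the crossing point. -/
theorem exists_diagonal_of_exchange (hmn : m ≠ n)
    {X Y S : Matrix (Idx m n) (Idx m n) (PowerSeries (Comp m n))} {α β : ScalarSeries}
    (h : rOp α β * (legL (X.map inX) * legR (Y.map inY)) =
      legR (Y.map inY) * legL (X.map inX) * rOp α β)
    (hYS : Y * S = 1) (hSY : S * Y = 1) (k : ℕ)
    (hα : ∀ F : CompSeries m n, diagRestrict (α • F) =
      PowerSeries.X ^ k * (sdim m n • diagRestrict F))
    (hβ : ∀ F : CompSeries m n, diagRestrict (β • F) = -(PowerSeries.X ^ k * diagRestrict F)) :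
    ∃ z, superT X * superT S = Matrix.diagonal fun _ => z := by
  refine superT_mul_superT_eq_diagonal hmn ?_
  have h1 : legR (Y.map inY) * legR (S.map inY) = (1 : Matrix (Idx₂ m n) _ (CompSeries m n)) := by
    rw [legR_mul, ← Matrix.map_mul, hYS, Matrix.map_one _ (map_zero _) (map_one _), legR_one]
  have h2 : legR (S.map inY) * legR (Y.map inY) = (1 : Matrix (Idx₂ m n) _ (CompSeries m n)) := by
    rw [legR_mul, ← Matrix.map_mul, hSY, Matrix.map_one _ (map_zero _) (map_one _), legR_one]
  -- Multiplying by Y⁻¹ on both sides separates the variables in each term, so the diagonal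
  -- restriction can be computed.
  have h3 : legR (S.map inY) * rOp α β * legL (X.map inX) =
      legL (X.map inX) * rOp α β * legR (S.map inY) := by
    have := congrArg (fun M => legR (S.map inY) * M * legR (S.map inY)) h
    simpa only [mul_assoc, h1, mul_one, ← mul_assoc (legR (S.map inY)) (legR (Y.map inY)), h2,
      one_mul] using this
  ext a b : 1
  have h4 := congrArg (fun M : Matrix _ _ _ => diagRestrict (M a b)) h3
  simp only [rOp, mul_add, add_mul, mul_smul_comm, smul_mul_assoc, mul_one, Matrix.add_apply,
    Matrix.smul_apply, map_add, hα, hβ] at h4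
  rw [← map_legL, ← map_legR, ← map_flip inY, ← Matrix.map_mul, diagRestrict_map_mul_map,
    diagRestrict_map_mul_map', diagRestrict_map_mul_map', mul_assoc ((legL X).map inX), ← Matrix.map_mul,
    diagRestrict_map_mul_map, ← mul_smul_comm, ← mul_smul_comm, ← mul_neg, ← mul_neg, ← mul_add, ← mul_add] at h4
  -- The common factor X^k is what clearing denominators in the R-matrix leaves on the diagonal.
  have h5 := PowerSeries.X_pow_mul_cancel h4
  simp only [rOp, mul_add, add_mul, mul_smul_comm, smul_mul_assoc, mul_one, Matrix.add_apply,
    Matrix.smul_apply, neg_smul, one_smul, Matrix.neg_apply, neg_mul, mul_neg, mul_assoc] at h5 ⊢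
  exact h5

end Diagonal

/-! ### The quantum contraction z(u) -/

section QuantumContraction

variable {m n : ℕ}

theorem evenOp_T_succ (r : ℕ) (i j : Idx m n) : evenOp (T m n (r + 1)) i j = cgen (Gen.t i j r) := by
  simp only [evenOp, T, tCoef]
  rcases i <;> rcases j <;> simp [par]

theorem evenOp_T_zero : evenOp (T m n 0) = 1 := by
  ext i j
  simp only [evenOp, T, tCoef, Matrix.one_apply]
  rcases i <;> rcases j <;> simp [par]

theorem evenOp_TPlus (r : ℕ) (i j : Idx m n) :
    evenOp (TPlus m n r) i j = (if r = 0 ∧ i = j then 1 else 0) - cgen (Gen.s i j r) := by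
  simp only [evenOp, TPlus, tPlusCoef]
  rcases i <;> rcases j <;> simp [par]

theorem commute_of_commute_T_TPlus {z : Comp m n}
    (hT : ∀ r i j, Commute z (evenOp (T m n r) i j))
    (hTPlus : ∀ r i j, Commute z (evenOp (TPlus m n r) i j)) (w : Comp m n) : Commute z w := by
  refine commute_of_commute_cgen (fun a => ?_) w
  cases a with
  | C => exact (commute_cgen_C z).symm
  | t i j r => simpa [evenOp_T_succ] using hT (r + 1) i j
  | s i j r =>
    have h := hTPlus r i j
    rw [evenOp_TPlus] at h
    have h1 : Commute z (if r = 0 ∧ i = j then 1 else 0) := by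
      split_ifs
      · exact Commute.one_right z
      · exact Commute.zero_right z
    simpa using h1.sub_right h

variable (m n) in
/-- The substitution `f(u) ↦ f(u + m - n)` in the outer variable. -/
def outerShift : CompSeries m n →+* CompSeries m n :=
  shiftHom (scalarHom₁ m n (cS (sdim m n))) (commute_scalarHom₁ _)

theorem outerShift_scalarHom (z : ScalarSeries) : outerShift m n (algebraMap ScalarSeries _ z) =
    algebraMap ScalarSeries (CompSeries m n) (shiftHom (cS (sdim m n)) (Commute.all _) z) := by
  change outerShift m n (scalarHom m n z) = scalarHom m n _
  rw [outerShift, scalarHom, shiftHom_map _ _ (Commute.all _) (commute_scalarHom₁ _)]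

theorem outerShift_inY (f : PowerSeries (Comp m n)) : outerShift m n (inY f) = inY f :=
  shiftHom_C _ _ f

theorem commute_algebraMap_sdim (w : Comp m n) :
    Commute (algebraMap ℂ (Comp m n) (sdim m n)) w := Algebra.commutes _ _

variable (m n) in
/-- The matrix of series `T(u + m - n)`. -/
def shiftedT : Matrix (Idx m n) (Idx m n) (PowerSeries (Comp m n)) :=
  (serMat (T m n)).map (shiftHom (algebraMap ℂ (Comp m n) (sdim m n)) commute_algebraMap_sdim)

theorem serMat_TShift : serMat (TShift m n) = shiftedT m n := by
  ext i j N
  rw [shiftedT, Matrix.map_apply, coeff_shiftHom, coeff_serMat]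
  simp only [coeff_serMat, evenOp, TShift, sdim]
  rcases i <;> rcases j <;> simp [par, shiftSeries]

theorem outerShift_inX (f : PowerSeries (Comp m n)) : outerShift m n (inX f) =
    inX (shiftHom (algebraMap ℂ (Comp m n) (sdim m n)) commute_algebraMap_sdim f) := by
  have h : scalarHom₁ m n (cS (sdim m n)) = PowerSeries.C (algebraMap ℂ (Comp m n) (sdim m n)) :=
    scalarHom₁_cS _
  have h' : ∀ a, Commute (PowerSeries.C (algebraMap ℂ (Comp m n) (sdim m n))) a := by
    rw [← h]
    exact commute_scalarHom₁ _
  rw [inX, shiftHom_map _ _ commute_algebraMap_sdim h', outerShift]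
  congr 2

theorem exchange_outerShift {Y : Matrix (Idx m n) (Idx m n) (PowerSeries (Comp m n))}
    {αa βa αb βb : ScalarSeries}
    (h : rOp αa βa * (legL ((serMat (T m n)).map inX) * legR (Y.map inY)) =
      legR (Y.map inY) * legL ((serMat (T m n)).map inX) * rOp αb βb) :
    rOp (shiftHom (cS (sdim m n)) (Commute.all _) αa) (shiftHom (cS (sdim m n)) (Commute.all _) βa) *
        (legL ((shiftedT m n).map inX) * legR (Y.map inY)) =
      legR (Y.map inY) * legL ((shiftedT m n).map inX) *
        rOp (shiftHom (cS (sdim m n)) (Commute.all _) αb)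
          (shiftHom (cS (sdim m n)) (Commute.all _) βb) := by
  have h1 := congrArg (fun M => M.map (outerShift m n)) h
  simp only [Matrix.map_mul, map_legL, map_legR,
    map_rOp (outerShift m n) (shiftHom (cS (sdim m n)) (Commute.all _)) outerShift_scalarHom] at h1
  have hX : ((serMat (T m n)).map inX).map (outerShift m n) = (shiftedT m n).map inX := by
    ext i j : 1
    simp only [Matrix.map_apply, outerShift_inX, shiftedT]
  have hY : (Y.map inY).map (outerShift m n) = Y.map inY := by
    ext i j : 1
    simp only [Matrix.map_apply, outerShift_inY]
  rwa [hX, hY] at h1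

variable (m n) in
/-- The scalar `m - n` as a constant series. -/
def cc : ScalarSeries := PowerSeries.C (cS (sdim m n))

theorem cc_eq : cc m n = (m : ScalarSeries) - n := by
  simp [cc, sdim]

/-- Shifting turns x = u⁻¹ into x/(1 + cx), and the factor 1 + cx clears this denominator. The
result y + cxy - x equals (u + c - v)u⁻¹v⁻¹. -/
theorem exchange_shiftedT :
    rOp (yS + cc m n * xS * yS - xS) (-(xS * yS)) *
        (legL ((shiftedT m n).map inX) * legR ((serMat (T m n)).map inY)) =
      legR ((serMat (T m n)).map inY) * legL ((shiftedT m n).map inX) *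
        rOp (yS + cc m n * xS * yS - xS) (-(xS * yS)) := by
  have h := exchange_smul (1 + cc m n * xS) (exchange_outerShift (exchange_T (m := m) (n := n)))
  have hx : shiftHom (cS (sdim m n)) (Commute.all _) xS * (1 + cc m n * xS) = xS :=
    shiftHom_X (cS (sdim m n)) (Commute.all _)
  have hy : shiftHom (cS (sdim m n)) (Commute.all _) yS = yS := shiftHom_C _ _ _
  have e1 : (1 + cc m n * xS) * shiftHom (cS (sdim m n)) (Commute.all _) (yS - xS) =
      yS + cc m n * xS * yS - xS := by
    rw [map_sub, hy]
    linear_combination -hx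
  have e2 : (1 + cc m n * xS) * shiftHom (cS (sdim m n)) (Commute.all _) (-(xS * yS)) =
      -(xS * yS) := by
    rw [map_neg, map_mul, hy]
    linear_combination -yS * hx
  rwa [e1, e2] at h

theorem coeff_commute_of_commute_inX_inY {f g : PowerSeries (Comp m n)}
    (h : inX f * inY g = inY g * inX f) (a b : ℕ) :
    Commute (PowerSeries.coeff a f) (PowerSeries.coeff b g) := by
  have := congrArg (fun F => PowerSeries.coeff b (PowerSeries.coeff a F)) h
  rwa [inX, inY, PowerSeries.coeff_mul_C, PowerSeries.coeff_C_mul, PowerSeries.coeff_map,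
    PowerSeries.coeff_C_mul, PowerSeries.coeff_mul_C] at this

theorem smul_eq_zero_of_constantCoeff {p : ScalarSeries}
    (hp : ∀ f : PowerSeries (Comp m n),
      scalarHom₁ m n (PowerSeries.constantCoeff p) * f = 0 → f = 0)
    (e : CompSeries m n) (h : p • e = 0) : e = 0 := by
  rw [scalar_smul_def] at h
  refine eq_zero_of_constantCoeff_mul (fun a ha => hp a ?_) h
  rwa [← PowerSeries.coeff_zero_eq_constantCoeff_apply, scalarHom, PowerSeries.coeff_map,
    PowerSeries.coeff_zero_eq_constantCoeff_apply] at ha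

theorem constantCoeff_gShift (e : PowerSeries (Polynomial ℂ)) :
    PowerSeries.constantCoeff (gShift m n e) = 1 := by
  rw [gShift, ← PowerSeries.coeff_zero_eq_constantCoeff_apply, coeff_shiftHom]
  simp [shiftSeries, gS, gCoef]

theorem constantCoeff_invShift (e : PowerSeries (Polynomial ℂ)) :
    PowerSeries.constantCoeff (invShift e) = 0 := constantCoeff_shiftHom_X _ _

/-- Inverses of matrices of series with coefficients in a subalgebra. -/
theorem exists_inverse_mem (V : Subalgebra ℂ (Comp m n))
    (F : PowerSeries (Matrix (Idx m n) (Idx m n) (Comp m n)))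
    (h0 : PowerSeries.constantCoeff F = 1) (hF : ∀ N i j, PowerSeries.coeff N F i j ∈ V) :
    ∃ S, F * S = 1 ∧ S * F = 1 ∧ ∀ N i j, PowerSeries.coeff N S i j ∈ V := by
  -- The inversion is carried out over the subalgebra, so membership of the coefficients is
  -- automatic.
  let F' : PowerSeries (Matrix (Idx m n) (Idx m n) V) :=
    PowerSeries.mk fun N => Matrix.of fun i j => ⟨PowerSeries.coeff N F i j, hF N i j⟩
  let φ : PowerSeries (Matrix (Idx m n) (Idx m n) V) →+*
    PowerSeries (Matrix (Idx m n) (Idx m n) (Comp m n)) :=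
    PowerSeries.map V.val.toRingHom.mapMatrix
  have hφ : φ F' = F := by
    ext N i j
    simp [φ, F']
  have h0' : PowerSeries.constantCoeff F' = ((1 : (Matrix (Idx m n) (Idx m n) V)ˣ) : Matrix _ _ V) := by
    ext i j
    have := congrFun (congrFun h0 i) j
    simp only [← PowerSeries.coeff_zero_eq_constantCoeff_apply] at this ⊢
    simp only [F', PowerSeries.coeff_mk, Matrix.of_apply, this]
    by_cases h : i = j <;> simp [h, Matrix.one_apply]
  refine ⟨φ (PowerSeries.invOfUnit F' 1), ?_, ?_, fun N i j => ?_⟩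
  · rw [← hφ, ← map_mul, PowerSeries.mul_invOfUnit _ _ h0', map_one]
  · rw [← hφ, ← map_mul, PowerSeries.invOfUnit_mul _ _ h0', map_one]
  · simp only [φ, PowerSeries.coeff_map]
    exact Subtype.property _

theorem map_inX_mul_eq_one {X S : Matrix (Idx m n) (Idx m n) (PowerSeries (Comp m n))}
    (h : X * S = 1) : X.map inX * S.map inX = 1 := by
  rw [← Matrix.map_mul, h, Matrix.map_one _ (map_zero _) (map_one _)]

theorem superT_map_mul {R R' : Type*} [Ring R] [Ring R'] (f : R →+* R')
    {X S : Matrix (Idx m n) (Idx m n) R} {z : R}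
    (h : superT X * superT S = Matrix.diagonal fun _ => z) :
    superT (X.map f) * superT (S.map f) = Matrix.diagonal fun _ => f z := by
  rw [← map_superT, ← map_superT, ← Matrix.map_mul, h, Matrix.diagonal_map (map_zero f)]

theorem commute_T_of_contraction {S : Matrix (Idx m n) (Idx m n) (PowerSeries (Comp m n))}
    {z : PowerSeries (Comp m n)} (hTS : serMat (T m n) * S = 1) (hST : S * serMat (T m n) = 1)
    (hz : superT (shiftedT m n) * superT S = Matrix.diagonal fun _ => z) (N r : ℕ) (i j : Idx m n) :
    Commute (PowerSeries.coeff N z) (evenOp (T m n r) i j) := by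
  rw [← coeff_serMat]
  refine coeff_commute_of_commute_inX_inY ?_ N r
  refine commute_of_exchange (E := CompSeries m n) (κa := yS - xS) (κb := yS - xS) (μa := xS * yS)
    (μb := xS * yS) exchange_T exchange_shiftedT (map_inX_mul_eq_one hTS) (map_inX_mul_eq_one hST)
    (superT_map_mul inX hz) rfl (by ring) rfl (by ring) rfl ?_ rfl ?_ rfl (fun e he => ?_) i j
  · rw [← cc_eq]; ring
  · rw [← cc_eq]; ring
  · refine smul_eq_zero_of_constantCoeff (fun f hf => ?_) e he
    -- At x = 0 the scalar to be cancelled reduces to y⁴, which is regular.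
    have : PowerSeries.constantCoeff (((yS - xS) * (yS - xS) + -(xS * yS) * (xS * yS)) *
        ((yS + cc m n * xS * yS - xS) * (yS - xS))) = PowerSeries.X ^ 4 := by
      simp only [map_mul, map_add, map_sub, map_neg]
      simp only [xS, yS, PowerSeries.constantCoeff_X, PowerSeries.constantCoeff_C]
      ring
    rw [this, map_pow, scalarHom₁, PowerSeries.map_X] at hf
    exact PowerSeries.X_pow_mul_cancel (hf.trans (mul_zero _).symm)

/-- Here the R-matrices on the two sides have different arguments u - v ± C/2, so the normalization
matters: g(u + c) = (1 - u⁻²)g(u) makes the crossing scalar equal to the inversion scalar at each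
argument. -/
theorem commute_TPlus_of_contraction (hmn : m ≠ n)
    {S : Matrix (Idx m n) (Idx m n) (PowerSeries (Comp m n))}
    {z : PowerSeries (Comp m n)} (hTS : serMat (T m n) * S = 1) (hST : S * serMat (T m n) = 1)
    (hz : superT (shiftedT m n) * superT S = Matrix.diagonal fun _ => z) (N r : ℕ) (i j : Idx m n) :
    Commute (PowerSeries.coeff N z) (evenOp (TPlus m n r) i j) := by
  have hg : ∀ e, shiftHom (cS (sdim m n)) (Commute.all _) (gShift m n e) =
      (1 - invShift e ^ 2) * gShift m n e := fun e => by
    rw [← gShift_add hmn, gShift, shiftHom_comp _ _ _ _ _ (Commute.all _) (add_comm _ _), gShift]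
  have hi : ∀ e, shiftHom (cS (sdim m n)) (Commute.all _) (invShift e) *
      (1 + cc m n * invShift e) = invShift e := fun e => by
    rw [invShift, shiftHom_comp _ _ _ _ _ (Commute.all _) (add_comm _ _)]
    exact invShift_add e _
  have h' := exchange_outerShift (exchange_mixed (m := m) (n := n))
  rw [← coeff_serMat]
  refine coeff_commute_of_commute_inX_inY ?_ N r
  set a := shiftParam (1 / 2)
  set b := shiftParam (-(1 / 2))
  simp only [map_neg, map_mul, hg] at h'
  have ha := hi a
  have hb := hi b
  set a' := shiftHom (cS (sdim m n)) (Commute.all _) (invShift a)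
  set b' := shiftHom (cS (sdim m n)) (Commute.all _) (invShift b)
  refine commute_of_exchange (E := CompSeries m n) (κa := 1) (κb := 1) (μa := invShift a)
    (μb := invShift b) exchange_mixed h' (map_inX_mul_eq_one hTS) (map_inX_mul_eq_one hST)
    (superT_map_mul inX hz) rfl (by ring) rfl (by ring) rfl ?_ rfl ?_ (by ring)
    (fun e he => ?_) i j
  · rw [← cc_eq]
    linear_combination -(1 - invShift a ^ 2) * gShift m n a * ha
  · rw [← cc_eq]
    linear_combination -(1 - invShift b ^ 2) * gShift m n b * hb
  · refine smul_eq_zero_of_constantCoeff (fun f hf => ?_) e he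
    simpa [constantCoeff_gShift, constantCoeff_invShift] using hf

theorem mem_coeff_mul {V : Subalgebra ℂ (Comp m n)} {f g : PowerSeries (Comp m n)}
    (hf : ∀ N, PowerSeries.coeff N f ∈ V) (hg : ∀ N, PowerSeries.coeff N g ∈ V) (N : ℕ) :
    PowerSeries.coeff N (f * g) ∈ V := by
  rw [PowerSeries.coeff_mul]
  exact Subalgebra.sum_mem _ fun x _ => V.mul_mem (hf _) (hg _)

theorem coeff_serMat_T_mem (N : ℕ) (i j : Idx m n) :
    PowerSeries.coeff N (serMat (T m n) i j) ∈ Yangian m n := by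
  rw [coeff_serMat]
  rcases N with _ | N
  · rw [evenOp_T_zero, Matrix.one_apply]
    split_ifs
    exacts [one_mem _, zero_mem _]
  · rw [evenOp_T_succ]
    exact Algebra.subset_adjoin ⟨i, j, N, rfl⟩

theorem coeff_shiftedT_mem (N : ℕ) (i j : Idx m n) :
    PowerSeries.coeff N (shiftedT m n i j) ∈ Yangian m n := by
  rw [shiftedT, Matrix.map_apply, coeff_shiftHom, shiftSeries]
  refine Subalgebra.sum_mem _ fun r _ => Subalgebra.zsmul_mem _ (mul_mem (coeff_serMat_T_mem _ _ _)
    (pow_mem (Subalgebra.algebraMap_mem _ _) _)) _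

theorem coeff_superT_mem {V : Subalgebra ℂ (Comp m n)}
    {X : Matrix (Idx m n) (Idx m n) (PowerSeries (Comp m n))}
    (hX : ∀ N i j, PowerSeries.coeff N (X i j) ∈ V) (N : ℕ) (i j : Idx m n) :
    PowerSeries.coeff N (superT X i j) ∈ V := by
  simp only [superT]
  rcases neg_one_pow_eq_or (PowerSeries (Comp m n)) (par i * par j + par i) with h | h
  · simpa [h] using hX N j i
  · simpa [h] using hX N j i

theorem nonempty_idx (hmn : m ≠ n) : Nonempty (Idx m n) := by
  rcases Nat.eq_zero_or_pos m with h | h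
  · exact ⟨Sum.inr ⟨0, by omega⟩⟩
  · exact ⟨Sum.inl ⟨0, h⟩⟩

theorem exists_quantumContraction (hmn : m ≠ n) : ∃ z : ℕ → Comp m n, IsQuantumContraction z ∧
    (∀ N, z N ∈ Yangian m n) ∧ ∀ N w, Commute (z N) w := by
  obtain ⟨S, hTS, hST, hS⟩ := exists_inverse_mem (Yangian m n) (opSeries (T m n))
    (by rw [← PowerSeries.coeff_zero_eq_constantCoeff_apply, opSeries, PowerSeries.coeff_mk,
      evenOp_T_zero])
    (fun N i j => by
      rw [opSeries, PowerSeries.coeff_mk, ← coeff_serMat]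
      exact coeff_serMat_T_mem N i j)
  have h1 : serMat (T m n) * matOfSeries S = 1 := by rw [serMat, ← map_mul, hTS, map_one]
  have h2 : matOfSeries S * serMat (T m n) = 1 := by rw [serMat, ← map_mul, hST, map_one]
  -- On x = y the coefficients y + cxy - x and -xy become cX² and -X², hence the exponent 2.
  obtain ⟨z, hz⟩ := exists_diagonal_of_exchange hmn exchange_shiftedT h1 h2 2
    (fun F => by
      rw [sub_smul, add_smul, mul_assoc, mul_smul, mul_smul, map_sub, map_add, cc,
        diagRestrict_cS_smul, diagRestrict_xS_smul, diagRestrict_xS_smul, diagRestrict_yS_smul,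
        add_sub_cancel_left, pow_two, mul_assoc, mul_smul_comm, mul_smul_comm])
    (fun F => by
      rw [neg_smul, mul_smul, map_neg, diagRestrict_xS_smul, diagRestrict_yS_smul, pow_two,
        mul_assoc])
  obtain ⟨i⟩ := nonempty_idx hmn
  refine ⟨fun N => PowerSeries.coeff N z, ?_, fun N => ?_, fun N => ?_⟩
  · refine isContraction_of_superT_mul hTS hST ?_
    have : PowerSeries.mk (fun N => PowerSeries.coeff N z) = z := by ext; simp
    rw [this, ← hz, ← serMat_TShift, serMat]
  · have : z = (superT (shiftedT m n) * superT (matOfSeries S)) i i := by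
      rw [hz, Matrix.diagonal_apply_eq]
    beta_reduce
    rw [this, Matrix.mul_apply, map_sum]
    refine Subalgebra.sum_mem _ fun k _ => mem_coeff_mul
      (fun N => coeff_superT_mem coeff_shiftedT_mem _ _ _)
      (fun N => coeff_superT_mem (fun N i j => ?_) _ _ _) N
    rw [coeff_matOfSeries]
    exact hS N i j
  · exact commute_of_commute_T_TPlus (commute_T_of_contraction h1 h2 hz N)
      (commute_TPlus_of_contraction hmn h1 h2 hz N)

end QuantumContraction

/-! ### Convergence in the extended dual Yangian -/

section ExtendedDual

variable (m n : ℕ)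

instance : NonarchimedeanRing (DY m n) := (nbhd_basis m n).nonarchimedean

variable {m n}

theorem tendsto_cofinite_zero_of_mem_fil {p : ℕ → DY m n} (h : ∀ k : ℕ, p k ∈ fil m n (-(k : ℤ))) :
    Tendsto p cofinite (𝓝 0) := by
  rw [Nat.cofinite_eq_atTop]
  refine ((nbhd_basis m n).hasBasis_nhds_zero.tendsto_right_iff).mpr fun k _ => ?_
  filter_upwards [eventually_ge_atTop k] with l hl
  exact fil_mono (by simpa using hl) (h l)

theorem summable_of_mem_fil {p : ℕ → DY m n} (h : ∀ k : ℕ, p k ∈ fil m n (-(k : ℤ))) :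
    Summable fun k => (p k : Comp m n) := by
  refine NonarchimedeanAddGroup.summable_of_tendsto_cofinite_zero ?_
  have := (UniformSpace.Completion.continuous_coe (DY m n)).tendsto 0
  rw [UniformSpace.Completion.coe_zero] at this
  exact this.comp (tendsto_cofinite_zero_of_mem_fil h)

theorem dualFil_mono {p q : ℕ} (h : p ≤ q) : dualFil m n q ≤ dualFil m n p :=
  Submodule.span_mono fun _ ⟨l, hl, hx⟩ => ⟨l, h.trans hl, hx⟩

theorem mul_mem_dualFil {p q : ℕ} {x y : DY m n} (hx : x ∈ dualFil m n p)
    (hy : y ∈ dualFil m n q) : x * y ∈ dualFil m n (p + q) := by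
  have h : dualFil m n p * dualFil m n q ≤ dualFil m n (p + q) := by
    rw [dualFil, dualFil, Submodule.span_mul_span]
    refine Submodule.span_mono ?_
    rintro _ ⟨_, ⟨l, hl, rfl⟩, _, ⟨l', hl', rfl⟩, rfl⟩
    exact ⟨l ++ l', by simpa using add_le_add hl hl', by simp⟩
  exact h (Submodule.mul_mem_mul hx hy)

theorem one_mem_dualFil : (1 : DY m n) ∈ dualFil m n 0 :=
  Submodule.subset_span ⟨[], by simp, by simp⟩

theorem gen_mem_dualFil (i j : Idx m n) (r : ℕ) : gen (Gen.s i j r) ∈ dualFil m n (r + 1) :=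
  Submodule.subset_span ⟨[(i, j, r)], by simp, by simp⟩

/-- Degree r in the descending filtration is degree -r in the ascending one, so dual series converge
in the topology of the double Yangian. -/
theorem dualFil_le_fil (p : ℕ) : dualFil m n p ≤ fil m n (-(p : ℤ)) := by
  refine Submodule.span_mono ?_
  rintro _ ⟨l, hl, rfl⟩
  refine ⟨l.map fun a => Gen.s a.1 a.2.1 a.2.2, ?_, by simp [Function.comp_def]⟩
  have h : ((l.map fun a => Gen.s a.1 a.2.1 a.2.2).map Gen.deg).sum =
      -(((l.map fun a => a.2.2 + 1).sum : ℕ) : ℤ) := by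
    clear hl
    induction l with
    | nil => simp
    | cons a l ih => rw [List.map_cons, List.map_cons, List.sum_cons, ih]; simp [Gen.deg]; ring
  rw [h]
  exact neg_le_neg (by exact_mod_cast hl)

/-- Multiplying by an element of the dual Yangian therefore never lowers the filtration degree. -/
theorem mem_dualYangian_iff {x : DY m n} : x ∈ DualYangian m n ↔ x ∈ dualFil m n 0 := by
  constructor
  · intro h
    induction h using Algebra.adjoin_induction with
    | mem x hx =>
      obtain ⟨i, j, r, rfl⟩ := hx
      exact dualFil_mono (Nat.zero_le (r + 1)) (gen_mem_dualFil i j r)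
    | algebraMap r =>
      rw [Algebra.algebraMap_eq_smul_one]
      exact Submodule.smul_mem _ _ one_mem_dualFil
    | add x y _ _ hx hy => exact Submodule.add_mem _ hx hy
    | mul x y _ _ hx hy =>
      have h' := mul_mem_dualFil hx hy
      rwa [add_zero] at h'
  · intro h
    have h' : dualFil m n 0 ≤ Subalgebra.toSubmodule (DualYangian m n) := by
      rw [dualFil, Submodule.span_le]
      rintro _ ⟨l, -, rfl⟩
      refine Subalgebra.list_prod_mem (DualYangian m n) fun x hx => ?_
      obtain ⟨a, -, rfl⟩ := List.mem_map.mp hx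
      exact Algebra.subset_adjoin ⟨a.1, a.2.1, a.2.2, rfl⟩
    exact h' h

variable (m n) in
/-- The inclusion of the double Yangian into its completion. -/
def compCoe : DY m n →ₐ[ℂ] Comp m n where
  toRingHom := UniformSpace.Completion.coeRingHom
  commutes' r := by rw [UniformSpace.Completion.algebraMap_def]; rfl

theorem compCoe_apply (x : DY m n) : compCoe m n x = (x : Comp m n) := rfl

variable (m n) in
/-- The filtration of the dual Yangian, inside the completed double Yangian. -/
def compFil (p : ℕ) : Submodule ℂ (Comp m n) := (dualFil m n p).map (compCoe m n).toLinearMap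

theorem compFil_mono {p q : ℕ} (h : p ≤ q) : compFil m n q ≤ compFil m n p :=
  Submodule.map_mono (dualFil_mono h)

theorem mul_mem_compFil {p q : ℕ} {x y : Comp m n} (hx : x ∈ compFil m n p)
    (hy : y ∈ compFil m n q) : x * y ∈ compFil m n (p + q) := by
  obtain ⟨x, hx, rfl⟩ := hx
  obtain ⟨y, hy, rfl⟩ := hy
  exact ⟨x * y, mul_mem_dualFil hx hy, map_mul (compCoe m n) x y⟩

theorem one_mem_compFil : (1 : Comp m n) ∈ compFil m n 0 :=
  ⟨1, one_mem_dualFil, map_one (compCoe m n)⟩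

theorem cgen_mem_compFil (i j : Idx m n) (r : ℕ) : cgen (Gen.s i j r) ∈ compFil m n (r + 1) :=
  ⟨_, gen_mem_dualFil i j r, rfl⟩

theorem TPlus_mem_compFil (r : ℕ) (i j : Idx m n) : TPlus m n r i j ∈ compFil m n r := by
  have h : (if r = 0 ∧ i = j then 1 else 0) - cgen (Gen.s i j r) ∈ compFil m n r := by
    refine Submodule.sub_mem _ ?_ (compFil_mono (Nat.le_succ r) (cgen_mem_compFil i j r))
    split_ifs with h
    · rw [h.1]
      exact one_mem_compFil
    · exact Submodule.zero_mem _
  rw [TPlus, tPlusCoef]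
  rcases neg_one_pow_eq_or (Comp m n) (par i * par j + par j) with h' | h'
  · rwa [h', one_mul]
  · rw [h', neg_one_mul]
    exact Submodule.neg_mem _ h

/-- Convergence of series in the extended dual Yangian. -/
theorem exists_hasSum_mem_extDualYangian {a : ℕ → Comp m n} (h : ∀ k, a k ∈ compFil m n k) :
    ∃ x ∈ ExtDualYangian m n, HasSum a x := by
  choose b hb hab using h
  obtain rfl : (fun k => (b k : Comp m n)) = a := funext hab
  obtain ⟨x, hx⟩ := summable_of_mem_fil fun k => dualFil_le_fil k (hb k)
  refine ⟨x, ⟨fun p => ∑ k ∈ Finset.range p, b k, fun p => ?_, fun p => ?_, ?_⟩, hx⟩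
  · exact Subalgebra.sum_mem _ fun k _ => mem_dualYangian_iff.mpr (dualFil_mono (Nat.zero_le k) (hb k))
  · beta_reduce
    rw [Finset.sum_range_succ, add_sub_cancel_left]
    exact hb p
  · have := hx.tendsto_sum_nat
    simp only [← compCoe_apply] at this
    simp only [← compCoe_apply, map_sum]
    exact this

variable (m n) in
/-- The extended dual Yangian as a subalgebra. -/
def extDualSubalgebra : Subalgebra ℂ (Comp m n) where
  carrier := ExtDualYangian m n
  mul_mem' := by
    rintro x x' ⟨y, hy, hd, hl⟩ ⟨y', hy', hd', hl'⟩
    refine ⟨fun p => y p * y' p, fun p => mul_mem (hy p) (hy' p), fun p => ?_, ?_⟩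
    · have e : y (p + 1) * y' (p + 1) - y p * y' p =
          (y (p + 1) - y p) * y' (p + 1) + y p * (y' (p + 1) - y' p) := by noncomm_ring
      have h1 := mul_mem_dualFil (hd p) (mem_dualYangian_iff.mp (hy' (p + 1)))
      have h2 := mul_mem_dualFil (mem_dualYangian_iff.mp (hy p)) (hd' p)
      rw [zero_add] at h2
      beta_reduce
      rw [e]
      exact Submodule.add_mem _ h1 h2
    · simpa only [UniformSpace.Completion.coe_mul] using hl.mul hl'
  add_mem' := by
    rintro x x' ⟨y, hy, hd, hl⟩ ⟨y', hy', hd', hl'⟩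
    refine ⟨fun p => y p + y' p, fun p => add_mem (hy p) (hy' p), fun p => ?_, ?_⟩
    · beta_reduce
      rw [add_sub_add_comm]
      exact Submodule.add_mem _ (hd p) (hd' p)
    · simpa only [UniformSpace.Completion.coe_add] using hl.add hl'
  algebraMap_mem' r := by
    refine ⟨fun _ => algebraMap ℂ (DY m n) r, fun p => Subalgebra.algebraMap_mem _ r, fun p => ?_, ?_⟩
    · rw [sub_self]
      exact Submodule.zero_mem _
    · rw [UniformSpace.Completion.algebraMap_def]
      exact tendsto_const_nhds

theorem mem_extDualSubalgebra {x : Comp m n} :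
    x ∈ extDualSubalgebra m n ↔ x ∈ ExtDualYangian m n := Iff.rfl

theorem exists_isTPlusShift : ∃ U : ℕ → Idx m n → Idx m n → Comp m n, IsTPlusShift U ∧
    ∀ N i j, U N i j ∈ ExtDualYangian m n := by
  choose U hU hsum using fun (N : ℕ) (i j : Idx m n) => exists_hasSum_mem_extDualYangian
    (a := fun r => (((r + N).choose N : ℂ) * ((m : ℂ) - n) ^ r) • TPlus m n (r + N) i j)
    fun r => Submodule.smul_mem _ _ (compFil_mono (Nat.le_add_right r N) (TPlus_mem_compFil _ _ _))
  exact ⟨U, hsum, hU⟩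

theorem coeff_one_sub_opSeries_TPlus (N : ℕ) (i j : Idx m n) :
    (PowerSeries.coeff N (1 - opSeries (TPlus m n)) : Matrix _ _ _) i j = cgen (Gen.s i j N) := by
  rw [map_sub, Matrix.sub_apply, opSeries, PowerSeries.coeff_mk, evenOp_TPlus, PowerSeries.coeff_one]
  by_cases hN : N = 0 <;> by_cases h : i = j <;> simp [hN, h, Matrix.one_apply]

/-- Each coefficient of 1 - T⁺(u) is a single generator of positive filtration degree, so every
factor contributes at least 1. -/
theorem coeff_pow_mem_compFil (k N : ℕ) (i j : Idx m n) :
    (PowerSeries.coeff N ((1 - opSeries (TPlus m n)) ^ k) : Matrix _ _ _) i j ∈ compFil m n k := by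
  induction k generalizing N i j with
  | zero =>
    rw [pow_zero, PowerSeries.coeff_one]
    split_ifs
    · rw [Matrix.one_apply]
      split_ifs
      exacts [one_mem_compFil, Submodule.zero_mem _]
    · exact Submodule.zero_mem _
  | succ k ih =>
    rw [pow_succ, PowerSeries.coeff_mul, Matrix.sum_apply]
    refine Submodule.sum_mem _ fun x _ => ?_
    rw [Matrix.mul_apply]
    refine Submodule.sum_mem _ fun l _ => mul_mem_compFil (ih _ _ _) ?_
    rw [coeff_one_sub_opSeries_TPlus]
    exact compFil_mono (by omega) (cgen_mem_compFil _ _ _)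

-- The constant term of T⁺(u) is not 1, so formal inversion in u is not available. The geometric
-- series of 1 - T⁺(u) converges coefficientwise because of the filtration.
open scoped PowerSeries.WithPiTopology in
theorem exists_inverse_TPlus : ∃ S, opSeries (TPlus m n) * S = 1 ∧ S * opSeries (TPlus m n) = 1 ∧
    ∀ N i j, PowerSeries.coeff N S i j ∈ ExtDualYangian m n := by
  choose S hS hsum using fun (N : ℕ) (i j : Idx m n) =>
    exists_hasSum_mem_extDualYangian fun k => coeff_pow_mem_compFil k N i j
  have h : HasSum (fun k => (1 - opSeries (TPlus m n)) ^ k)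
      (PowerSeries.mk fun N => Matrix.of (S N)) := by
    rw [PowerSeries.WithPiTopology.hasSum_iff_hasSum_coeff]
    intro N
    refine Pi.hasSum.mpr fun i => Pi.hasSum.mpr fun j => ?_
    rw [PowerSeries.coeff_mk]
    exact hsum N i j
  have h1 := h.summable.one_sub_mul_tsum_pow
  have h2 := h.summable.tsum_pow_mul_one_sub
  rw [h.tsum_eq, sub_sub_cancel] at h1 h2
  refine ⟨_, h1, h2, fun N i j => ?_⟩
  rw [PowerSeries.coeff_mk]
  exact hS N i j

end ExtendedDual

/-! ### The shift u ↦ u + c for series in nonnegative powers -/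

section TaylorShift

variable {R : Type*} [Ring R] [Algebra ℂ R] [TopologicalSpace R]
  {c : ℂ} {f f' F F' : PowerSeries R}

/-- `F(u) = f(u + c)`, where every coefficient of `f(u + c)` is a convergent series. -/
def IsTaylorShift (c : ℂ) (f F : PowerSeries R) : Prop :=
  ∀ N, HasSum (fun r => (((r + N).choose N : ℂ) * c ^ r) • PowerSeries.coeff (r + N) f)
    (PowerSeries.coeff N F)

theorem IsTaylorShift.unique [T2Space R] (h : IsTaylorShift c f F) (h' : IsTaylorShift c f F') :
    F = F' := by
  ext N
  exact (h N).unique (h' N)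

theorem IsTaylorShift.zero : IsTaylorShift c (0 : PowerSeries R) 0 := fun N => by
  simpa only [map_zero, smul_zero] using hasSum_zero

variable [IsTopologicalRing R]

theorem IsTaylorShift.add (h : IsTaylorShift c f F) (h' : IsTaylorShift c f' F') :
    IsTaylorShift c (f + f') (F + F') := fun N => by
  simpa only [map_add, smul_add] using (h N).add (h' N)

theorem IsTaylorShift.neg (h : IsTaylorShift c f F) : IsTaylorShift c (-f) (-F) := fun N => by
  simpa only [map_neg, smul_neg] using (h N).neg

theorem IsTaylorShift.sum {ι : Type*} (s : Finset ι) {g G : ι → PowerSeries R}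
    (h : ∀ i ∈ s, IsTaylorShift c (g i) (G i)) : IsTaylorShift c (∑ i ∈ s, g i) (∑ i ∈ s, G i) := by
  classical
  induction s using Finset.induction_on with
  | empty => simpa using IsTaylorShift.zero
  | insert a s ha ih =>
    rw [Finset.sum_insert ha, Finset.sum_insert ha]
    exact (h a (Finset.mem_insert_self a s)).add (ih fun i hi => h i (Finset.mem_insert_of_mem hi))

end TaylorShift

section TaylorShift

variable {R : Type*} [Ring R] [Algebra ℂ R] [TopologicalSpace R] [IsTopologicalRing R]
  {c : ℂ} {f F : PowerSeries R}

theorem IsTaylorShift.C_mul (a : R) (h : IsTaylorShift c f F) :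
    IsTaylorShift c (PowerSeries.C a * f) (PowerSeries.C a * F) := fun N => by
  simpa only [PowerSeries.coeff_C_mul, mul_smul_comm] using (h N).mul_left a

theorem IsTaylorShift.mul_C (a : R) (h : IsTaylorShift c f F) :
    IsTaylorShift c (f * PowerSeries.C a) (F * PowerSeries.C a) := fun N => by
  simpa only [PowerSeries.coeff_mul_C, smul_mul_assoc] using (h N).mul_right a

/-- Pascal's rule: the two summands of (u + c)F contribute binom(r+N, N) and binom(r+N, N+1). -/
theorem IsTaylorShift.X_mul [ContinuousConstSMul ℂ R] (h : IsTaylorShift c f F) :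
    IsTaylorShift c (PowerSeries.X * f)
      ((PowerSeries.X + PowerSeries.C (algebraMap ℂ R c)) * F) := by
  intro N
  have hc : HasSum (fun r => (((r + N).choose N : ℂ) * c ^ (r + 1)) •
      PowerSeries.coeff (r + 1 + N) (PowerSeries.X * f)) (c • PowerSeries.coeff N F) := by
    refine HasSum.congr_fun ((h N).const_smul c) fun r => ?_
    rw [smul_smul, add_right_comm, PowerSeries.coeff_succ_X_mul, pow_succ]
    congr 1
    ring
  rw [add_mul, map_add, PowerSeries.coeff_C_mul, ← Algebra.smul_def]
  rcases N with _ | N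
  · have h1 := HasSum.zero_add (f := fun r => (((r + 0).choose 0 : ℂ) * c ^ r) •
      PowerSeries.coeff (r + 0) (PowerSeries.X * f)) (m := c • PowerSeries.coeff 0 F) (by simpa using hc)
    simpa using h1
  -- The summation index of the c-part is lowered by one; the extra term at r = 0 carries binom(N,
  -- N+1) = 0.
  · have h1 := HasSum.zero_add (f := fun r => (((r + N).choose (N + 1) : ℂ) * c ^ r) •
      PowerSeries.coeff (r + (N + 1)) (PowerSeries.X * f))
      (m := c • PowerSeries.coeff (N + 1) F) (by simpa only [add_assoc, add_comm 1] using hc)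
    rw [zero_add, Nat.choose_succ_self, Nat.cast_zero, zero_mul, zero_smul, zero_add] at h1
    rw [PowerSeries.coeff_succ_X_mul]
    refine HasSum.congr_fun ((h N).add h1) fun r => ?_
    rw [← add_assoc, PowerSeries.coeff_succ_X_mul, ← add_smul, ← add_mul, Nat.choose_succ_succ,
      Nat.cast_add]

variable (R c) in
/-- The pairs `(f(u), f(u + c))` of series. -/
def taylorPairs : AddSubgroup (PowerSeries R × PowerSeries R) where
  carrier := {p | IsTaylorShift c p.1 p.2}
  add_mem' h h' := h.add h'
  zero_mem' := IsTaylorShift.zero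
  neg_mem' h := h.neg

theorem mem_taylorPairs : (f, F) ∈ taylorPairs R c ↔ IsTaylorShift c f F := Iff.rfl

variable (R c) in
/-- The pairs `(f(u, v), f(u, v + c))` of series in an outer variable and an inner variable `v`. -/
def innerTaylorPairs : AddSubgroup (PowerSeries (PowerSeries R) × PowerSeries (PowerSeries R)) where
  carrier := {p | ∀ a, IsTaylorShift c (PowerSeries.coeff a p.1) (PowerSeries.coeff a p.2)}
  add_mem' h h' a := by
    simpa only [Prod.fst_add, Prod.snd_add, map_add] using (h a).add (h' a)
  zero_mem' a := by simpa only [Prod.fst_zero, Prod.snd_zero, map_zero] using IsTaylorShift.zero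
  neg_mem' h a := by simpa only [Prod.fst_neg, Prod.snd_neg, map_neg] using (h a).neg

end TaylorShift

/-! ### Transporting exchange relations along an additive relation -/

section AdditiveRelations

variable {m n : ℕ} {E J : Type*} [Ring E] [Fintype J] (S : AddSubgroup (E × E))

/-- S stands for the graph of a substitution that need be neither everywhere defined nor known to be
multiplicative. Only multiplication by factors compatible with it is used. -/
theorem mul_left_mem_pairs {M A B : Matrix J J E}
    (hM : ∀ p q f F, (f, F) ∈ S → (M p q * f, M p q * F) ∈ S)
    (h : ∀ p q, (A p q, B p q) ∈ S) (p q : J) : ((M * A) p q, (M * B) p q) ∈ S := by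
  have e : ((M * A) p q, (M * B) p q) = ∑ l, (M p l * A l q, M p l * B l q) := by
    ext <;> simp [Matrix.mul_apply, Prod.fst_sum, Prod.snd_sum]
  rw [e]
  exact AddSubgroup.sum_mem _ fun l _ => hM _ _ _ _ (h _ _)

theorem mul_right_mem_pairs {M A B : Matrix J J E}
    (hM : ∀ p q f F, (f, F) ∈ S → (f * M p q, F * M p q) ∈ S)
    (h : ∀ p q, (A p q, B p q) ∈ S) (p q : J) : ((A * M) p q, (B * M) p q) ∈ S := by
  have e : ((A * M) p q, (B * M) p q) = ∑ l, (A p l * M l q, B p l * M l q) := by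
    ext <;> simp [Matrix.mul_apply, Prod.fst_sum, Prod.snd_sum]
  rw [e]
  exact AddSubgroup.sum_mem _ fun l _ => hM _ _ _ _ (h _ _)

theorem zero_mem_pairs : ((0 : E), (0 : E)) ∈ S := S.zero_mem

theorem neg_mem_pairs {f F : E} (h : (f, F) ∈ S) : (-f, -F) ∈ S := S.neg_mem h

theorem sub_mem_pairs {f F f' F' : E} (h : (f, F) ∈ S) (h' : (f', F') ∈ S) :
    (f - f', F - F') ∈ S := S.sub_mem h h'

theorem neg_one_pow_mul_mem_pairs (k : ℕ) {f F : E} (h : (f, F) ∈ S) :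
    ((-1) ^ k * f, (-1) ^ k * F) ∈ S := by
  rcases neg_one_pow_eq_or E k with h' | h'
  · simpa only [h', one_mul] using h
  · simpa only [h', neg_one_mul] using neg_mem_pairs S h

theorem mul_neg_one_pow_mem_pairs (k : ℕ) {f F : E} (h : (f, F) ∈ S) :
    (f * (-1) ^ k, F * (-1) ^ k) ∈ S := by
  rcases neg_one_pow_eq_or E k with h' | h'
  · simpa only [h', mul_one] using h
  · simpa only [h', mul_neg_one] using neg_mem_pairs S h

theorem legL_mem_pairs {X X' : Matrix (Idx m n) (Idx m n) E}
    (h : ∀ i j, (X i j, X' i j) ∈ S) (p q : Idx₂ m n) : (legL X p q, legL X' p q) ∈ S := by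
  simp only [legL]
  split_ifs
  · exact neg_one_pow_mul_mem_pairs S _ (h _ _)
  · exact S.zero_mem

theorem legR_mem_pairs {X X' : Matrix (Idx m n) (Idx m n) E}
    (h : ∀ i j, (X i j, X' i j) ∈ S) (p q : Idx₂ m n) : (legR X p q, legR X' p q) ∈ S := by
  simp only [legR]
  split_ifs
  · exact h _ _
  · exact S.zero_mem

theorem legL_mul_mem_pairs {X : Matrix (Idx m n) (Idx m n) E} {f F : E}
    (h : ∀ i j, (X i j * f, X i j * F) ∈ S) (p q : Idx₂ m n) :
    (legL X p q * f, legL X p q * F) ∈ S := by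
  simp only [legL]
  split_ifs
  · simpa only [mul_assoc] using neg_one_pow_mul_mem_pairs S _ (h _ _)
  · simpa only [zero_mul] using zero_mem_pairs S

theorem mul_legL_mem_pairs {X : Matrix (Idx m n) (Idx m n) E} {f F : E}
    (h : ∀ i j, (f * X i j, F * X i j) ∈ S) (p q : Idx₂ m n) :
    (f * legL X p q, F * legL X p q) ∈ S := by
  simp only [legL]
  split_ifs
  · simpa only [((Commute.neg_one_left _).pow_left _).eq, mul_assoc] using
      mul_neg_one_pow_mem_pairs S _ (h _ _)
  · simpa only [mul_zero] using zero_mem_pairs S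

theorem legR_mul_mem_pairs {X : Matrix (Idx m n) (Idx m n) E} {f F : E}
    (h : ∀ i j, (X i j * f, X i j * F) ∈ S) (p q : Idx₂ m n) :
    (legR X p q * f, legR X p q * F) ∈ S := by
  simp only [legR]
  split_ifs
  · exact h _ _
  · simpa only [zero_mul] using zero_mem_pairs S

theorem mul_legR_mem_pairs {X : Matrix (Idx m n) (Idx m n) E} {f F : E}
    (h : ∀ i j, (f * X i j, F * X i j) ∈ S) (p q : Idx₂ m n) :
    (f * legR X p q, F * legR X p q) ∈ S := by
  simp only [legR]
  split_ifs
  · exact h _ _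
  · simpa only [mul_zero] using zero_mem_pairs S

/-- A family of substitutions transforms an exchange relation into another one. -/
theorem exchange_of_mem_pairs {Z : Type*} [CommRing Z] [Algebra Z E]
    (hS : ∀ f F F', (f, F) ∈ S → (f, F') ∈ S → F = F')
    {A A' B B' : Matrix (Idx₂ m n) (Idx₂ m n) E}
    (hA : ∀ p q, (A p q, A' p q) ∈ S) (hB : ∀ p q, (B p q, B' p q) ∈ S)
    {αa βa αb βb αa' βa' αb' βb' : Z}
    (hαa : ∀ f F, (f, F) ∈ S → (αa • f, αa' • F) ∈ S)
    (hβa : ∀ f F, (f, F) ∈ S → (βa • f, βa' • F) ∈ S)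
    (hαb : ∀ f F, (f, F) ∈ S → (αb • f, αb' • F) ∈ S)
    (hβb : ∀ f F, (f, F) ∈ S → (βb • f, βb' • F) ∈ S)
    (h : rOp αa βa * A = B * rOp αb βb) : rOp αa' βa' * A' = B' * rOp αb' βb' := by
  have h1 : ∀ p q, ((rOp αa βa * A : Matrix _ _ _) p q, (rOp αa' βa' * A' : Matrix _ _ _) p q) ∈ S := fun p q => by
    simp only [rOp, add_mul, smul_mul_assoc, one_mul, Matrix.add_apply, Matrix.smul_apply,
      flip_mul_apply]
    exact S.add_mem (hαa _ _ (hA _ _)) (hβa _ _ (neg_one_pow_mul_mem_pairs S _ (hA _ _)))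
  have h2 : ∀ p q, ((B * rOp αb βb : Matrix _ _ _) p q, (B' * rOp αb' βb' : Matrix _ _ _) p q) ∈ S := fun p q => by
    simp only [rOp, mul_add, mul_smul_comm, mul_one, Matrix.add_apply, Matrix.smul_apply,
      mul_flip_apply]
    exact S.add_mem (hαb _ _ (hB _ _)) (hβb _ _ (mul_neg_one_pow_mem_pairs S _ (hB _ _)))
  ext p q : 2
  have := h1 p q
  rw [h] at this
  exact hS _ _ _ this (h2 p q)

end AdditiveRelations

/-! ### Exchange relations for T⁺(u + m - n) -/

section ShiftedTPlus

variable {m n : ℕ} {U : ℕ → Idx m n → Idx m n → Comp m n}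

theorem isTaylorShift_serMat (hU : IsTPlusShift U) (i j : Idx m n) :
    IsTaylorShift (sdim m n) (serMat (TPlus m n) i j) (serMat U i j) := fun N => by
  simpa only [coeff_serMat, evenOp, mul_smul_comm, sdim] using
    (hU N i j).mul_left ((-1) ^ ((par i + par j) * par j))

open scoped PowerSeries.WithPiTopology in
theorem isTaylorShift_inX {c : ℂ} {f F : PowerSeries (Comp m n)} (h : IsTaylorShift c f F) :
    IsTaylorShift c (inX f) (inX F) := fun N => by
  rw [PowerSeries.WithPiTopology.hasSum_iff_hasSum_coeff]
  intro d
  simp only [inX, PowerSeries.coeff_map]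
  rcases d with _ | d
  · simpa using h N
  · simp [hasSum_zero]

-- The substitution is in the outer variable u only: factors in v are constants for it, and u - v -
-- P becomes u + c - v - P.
open scoped PowerSeries.WithPiTopology in
theorem exchange_TPlusShift (hU : IsTPlusShift U) :
    rOp (xS + cc m n - yS) (-1) * (legL ((serMat U).map inX) *
        legR ((serMat (TPlus m n)).map inY)) =
      legR ((serMat (TPlus m n)).map inY) * legL ((serMat U).map inX) *
        rOp (xS + cc m n - yS) (-1) := by
  set S := taylorPairs (PowerSeries (Comp m n)) (sdim m n) with hS
  have hX : ∀ f F, (f, F) ∈ S → ((xS - yS) • f, (xS + cc m n - yS) • F) ∈ S := by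
    intro f F h
    rw [sub_smul, sub_smul]
    refine sub_mem_pairs S ?_ ?_
    · have := IsTaylorShift.X_mul (mem_taylorPairs.mp h)
      rw [scalar_smul_def, scalar_smul_def, map_add, scalarHom_xS]
      have hc : scalarHom m n (cc m n) =
          PowerSeries.C (algebraMap ℂ (PowerSeries (Comp m n)) (sdim m n)) := by
        simp [cc, scalarHom, scalarHom₁_cS, PowerSeries.algebraMap_apply]
      rw [hc]
      exact this
    · rw [scalar_smul_def, scalar_smul_def, scalarHom_yS]
      exact (mem_taylorPairs.mp h).C_mul _
  have h1 : ∀ f F, (f, F) ∈ S → ((-1 : ScalarSeries) • f, (-1 : ScalarSeries) • F) ∈ S := by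
    intro f F h
    rw [neg_smul, neg_smul, one_smul, one_smul]
    exact neg_mem_pairs S h
  have hL := legL_mem_pairs S (X := (serMat (TPlus m n)).map inX) (X' := (serMat U).map inX)
    fun i j => isTaylorShift_inX (isTaylorShift_serMat hU i j)
  refine exchange_of_mem_pairs S (fun f F F' h h' => h.unique h') ?_ ?_ hX h1 hX h1
    (exchange_TPlus (m := m) (n := n))
  · exact mul_right_mem_pairs S (fun p q f F h => mul_legR_mem_pairs S
      (fun i j => (mem_taylorPairs.mp h).mul_C _) p q) hL
  · exact mul_left_mem_pairs S (fun p q f F h => legR_mul_mem_pairs S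
      (fun i j => (mem_taylorPairs.mp h).C_mul _) p q) hL

/-- Multiplication by `p(v)` and `q(v) = p(v + c)` is compatible with the substitution `v ↦ v + c`. -/
def IsTaylorMultiplier (m n : ℕ) (c : ℂ) (p q : PowerSeries (Polynomial ℂ)) : Prop :=
  ∀ f F : PowerSeries (Comp m n), IsTaylorShift c f F →
    IsTaylorShift c (scalarHom₁ m n p * f) (scalarHom₁ m n q * F)

variable {c : ℂ} {p q p' q' : PowerSeries (Polynomial ℂ)}

theorem IsTaylorMultiplier.add (h : IsTaylorMultiplier m n c p q)
    (h' : IsTaylorMultiplier m n c p' q') : IsTaylorMultiplier m n c (p + p') (q + q') :=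
  fun f F hf => by simpa only [map_add, add_mul] using (h f F hf).add (h' f F hf)

theorem IsTaylorMultiplier.mul (h : IsTaylorMultiplier m n c p q)
    (h' : IsTaylorMultiplier m n c p' q') : IsTaylorMultiplier m n c (p * p') (q * q') :=
  fun f F hf => by simpa only [map_mul, mul_assoc] using h _ _ (h' f F hf)

theorem IsTaylorMultiplier.C (a : Polynomial ℂ) :
    IsTaylorMultiplier m n c (PowerSeries.C a) (PowerSeries.C a) := fun f F hf => by
  rw [scalarHom₁, PowerSeries.map_C]
  exact hf.C_mul _

theorem IsTaylorMultiplier.pow (h : IsTaylorMultiplier m n c p q) (k : ℕ) :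
    IsTaylorMultiplier m n c (p ^ k) (q ^ k) := by
  induction k with
  | zero => simpa only [pow_zero, map_one] using IsTaylorMultiplier.C 1
  | succ k ih =>
    rw [pow_succ, pow_succ]
    exact ih.mul h

theorem IsTaylorMultiplier.sum {ι : Type*} (s : Finset ι) {a b : ι → PowerSeries (Polynomial ℂ)}
    (h : ∀ i ∈ s, IsTaylorMultiplier m n c (a i) (b i)) :
    IsTaylorMultiplier m n c (∑ i ∈ s, a i) (∑ i ∈ s, b i) := fun f F hf => by
  rw [map_sum, map_sum, Finset.sum_mul, Finset.sum_mul]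
  exact IsTaylorShift.sum s fun i hi => h i hi f F hf

theorem isTaylorMultiplier_shiftParam (ε : ℂ) :
    IsTaylorMultiplier m n c (shiftParam ε) (shiftParam ε - cS c) := by
  have hX : IsTaylorMultiplier m n c PowerSeries.X (PowerSeries.X + cS c) := fun f F hf => by
    rw [map_add, scalarHom₁_cS, scalarHom₁, PowerSeries.map_X]
    exact hf.X_mul
  have h := ((IsTaylorMultiplier.C (-1)).mul hX).add (IsTaylorMultiplier.C
    (Polynomial.C ε * Polynomial.X))
  rw [map_neg, map_one, neg_one_mul, neg_one_mul] at h
  rw [shiftParam]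
  convert h using 1
  ring

/-- At a fixed power of u⁻¹ the coefficient is a polynomial in the shift parameter e, so only finite
sums and products of multipliers occur. -/
theorem isTaylorMultiplier_coeff_shiftHom {e e' : PowerSeries (Polynomial ℂ)}
    (h : IsTaylorMultiplier m n c e e') {G : ScalarSeries} {g : ℕ → ℂ}
    (hG : ∀ N, PowerSeries.coeff N G = cS (g N)) (N : ℕ) :
    IsTaylorMultiplier m n c (PowerSeries.coeff N (shiftHom e (Commute.all e) G))
      (PowerSeries.coeff N (shiftHom e' (Commute.all e') G)) := by
  rw [coeff_shiftHom, coeff_shiftHom, shiftSeries, shiftSeries]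
  refine IsTaylorMultiplier.sum _ fun r _ => ?_
  rw [hG, zsmul_eq_mul, zsmul_eq_mul]
  have h1 := (IsTaylorMultiplier.C (m := m) (n := n) (c := c)
    ((Ring.choose (-(r : ℤ)) (N - r) : ℤ) : Polynomial ℂ))
  rw [map_intCast] at h1
  exact h1.mul ((IsTaylorMultiplier.C (Polynomial.C (g r))).mul (h.pow _))

theorem smul_mem_innerTaylorPairs {P Q : ScalarSeries}
    (h : ∀ N, IsTaylorMultiplier m n c (PowerSeries.coeff N P) (PowerSeries.coeff N Q))
    (f F : CompSeries m n) (hf : (f, F) ∈ innerTaylorPairs (Comp m n) c) :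
    (P • f, Q • F) ∈ innerTaylorPairs (Comp m n) c := by
  intro N
  rw [scalar_smul_def, scalar_smul_def, PowerSeries.coeff_mul, PowerSeries.coeff_mul]
  refine IsTaylorShift.sum _ fun x _ => ?_
  rw [scalarHom, PowerSeries.coeff_map, PowerSeries.coeff_map]
  exact h _ _ _ (hf _)

theorem inX_mul_mem_innerTaylorPairs (g : PowerSeries (Comp m n)) {f F : CompSeries m n}
    (hf : (f, F) ∈ innerTaylorPairs (Comp m n) c) :
    (inX g * f, inX g * F) ∈ innerTaylorPairs (Comp m n) c := by
  intro N
  rw [PowerSeries.coeff_mul, PowerSeries.coeff_mul]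
  refine IsTaylorShift.sum _ fun x _ => ?_
  rw [inX, PowerSeries.coeff_map]
  exact (hf _).C_mul _

theorem mul_inX_mem_innerTaylorPairs (g : PowerSeries (Comp m n)) {f F : CompSeries m n}
    (hf : (f, F) ∈ innerTaylorPairs (Comp m n) c) :
    (f * inX g, F * inX g) ∈ innerTaylorPairs (Comp m n) c := by
  intro N
  rw [PowerSeries.coeff_mul, PowerSeries.coeff_mul]
  refine IsTaylorShift.sum _ fun x _ => ?_
  rw [inX, PowerSeries.coeff_map]
  exact (hf _).mul_C _

theorem inY_mem_innerTaylorPairs {f F : PowerSeries (Comp m n)} (h : IsTaylorShift c f F) :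
    (inY f, inY F) ∈ innerTaylorPairs (Comp m n) c := by
  intro N
  rw [inY, PowerSeries.coeff_C, PowerSeries.coeff_C]
  split_ifs
  · exact h
  · exact IsTaylorShift.zero

/-- T⁺ depends on v, so the substitution v ↦ v + c in the inner variable shifts the argument u - v ±
C/2 of the R-matrix by -c. -/
theorem exchange_mixed_TPlusShift (hU : IsTPlusShift U) :
    rOp (gShift m n (shiftParam (1 / 2) - cS (sdim m n)))
        (-(invShift (shiftParam (1 / 2) - cS (sdim m n)) *
          gShift m n (shiftParam (1 / 2) - cS (sdim m n)))) *
      (legL ((serMat (T m n)).map inX) * legR ((serMat U).map inY)) =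
      legR ((serMat U).map inY) * legL ((serMat (T m n)).map inX) *
        rOp (gShift m n (shiftParam (-(1 / 2)) - cS (sdim m n)))
          (-(invShift (shiftParam (-(1 / 2)) - cS (sdim m n)) *
            gShift m n (shiftParam (-(1 / 2)) - cS (sdim m n)))) := by
  set S := innerTaylorPairs (Comp m n) (sdim m n) with hS
  have hg : ∀ ε f F, (f, F) ∈ S → (gShift m n (shiftParam ε) • f,
      gShift m n (shiftParam ε - cS (sdim m n)) • F) ∈ S := fun ε =>
    smul_mem_innerTaylorPairs (isTaylorMultiplier_coeff_shiftHom (isTaylorMultiplier_shiftParam ε)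
      (g := gCoef (sdim m n)) fun N => by rw [gS, PowerSeries.coeff_map, PowerSeries.coeff_mk])
  have hi : ∀ ε f F, (f, F) ∈ S → (invShift (shiftParam ε) • f,
      invShift (shiftParam ε - cS (sdim m n)) • F) ∈ S := fun ε =>
    smul_mem_innerTaylorPairs (isTaylorMultiplier_coeff_shiftHom (isTaylorMultiplier_shiftParam ε)
      (g := fun N => if N = 1 then 1 else 0) fun N => by
        rw [PowerSeries.coeff_X]
        split_ifs <;> simp)
  have hgi : ∀ ε f F, (f, F) ∈ S → (-(invShift (shiftParam ε) * gShift m n (shiftParam ε)) • f,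
      -(invShift (shiftParam ε - cS (sdim m n)) *
        gShift m n (shiftParam ε - cS (sdim m n))) • F) ∈ S := fun ε f F h => by
    rw [neg_smul, neg_smul, mul_smul, mul_smul]
    exact neg_mem_pairs S (hi _ _ _ (hg _ _ _ h))
  have hR := legR_mem_pairs S (X := (serMat (TPlus m n)).map inY) (X' := (serMat U).map inY)
    fun i j => inY_mem_innerTaylorPairs (isTaylorShift_serMat hU i j)
  refine exchange_of_mem_pairs S (fun f F F' h h' => ?_) ?_ ?_ (hg _) (hgi _) (hg _) (hgi _)
    (exchange_mixed (m := m) (n := n))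
  · ext a : 1
    exact (h a).unique (h' a)
  · exact mul_left_mem_pairs S (fun p q f F h => legL_mul_mem_pairs S
      (fun i j => inX_mul_mem_innerTaylorPairs _ h) p q) hR
  · exact mul_right_mem_pairs S (fun p q f F h => mul_legL_mem_pairs S
      (fun i j => mul_inX_mem_innerTaylorPairs _ h) p q) hR

end ShiftedTPlus

/-! ### The dual contraction z⁺(u), and membership in the centre -/

section DualQuantumContraction

variable {m n : ℕ} {U : ℕ → Idx m n → Idx m n → Comp m n}
  {S : Matrix (Idx m n) (Idx m n) (PowerSeries (Comp m n))} {z : PowerSeries (Comp m n)}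

theorem exists_diagonal_TPlus (hmn : m ≠ n) (hU : IsTPlusShift U)
    (hTS : serMat (TPlus m n) * S = 1) (hST : S * serMat (TPlus m n) = 1) :
    ∃ z, superT (serMat U) * superT S = Matrix.diagonal fun _ => z :=
  exists_diagonal_of_exchange hmn (exchange_TPlusShift hU) hTS hST 0
    (fun F => by
      rw [sub_smul, add_smul, map_sub, map_add, cc, diagRestrict_cS_smul, diagRestrict_xS_smul,
        diagRestrict_yS_smul, add_sub_cancel_left, pow_zero, one_mul])
    (fun F => by rw [neg_smul, one_smul, map_neg, pow_zero, one_mul])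

theorem commute_TPlus_of_dualContraction (hmn : m ≠ n) (hU : IsTPlusShift U)
    (hTS : serMat (TPlus m n) * S = 1) (hST : S * serMat (TPlus m n) = 1)
    (hz : superT (serMat U) * superT S = Matrix.diagonal fun _ => z) (N r : ℕ) (i j : Idx m n) :
    Commute (PowerSeries.coeff N z) (evenOp (TPlus m n r) i j) := by
  rw [← coeff_serMat]
  refine coeff_commute_of_commute_inX_inY ?_ N r
  refine commute_of_exchange (E := CompSeries m n) (κa := xS - yS) (κb := xS - yS) (μa := 1)
    (μb := 1) exchange_TPlus (exchange_TPlusShift hU) (map_inX_mul_eq_one hTS)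
    (map_inX_mul_eq_one hST) (superT_map_mul inX hz) rfl (by ring) rfl (by ring) rfl ?_ rfl ?_ rfl
    (fun e he => ?_) i j
  · rw [← cc_eq]; ring
  · rw [← cc_eq]; ring
  · refine smul_eq_zero_of_constantCoeff (fun f hf => ?_) e he
    -- At x = 0 the scalar to be cancelled is y times a series with constant term c. The latter is a
    -- unit because m ≠ n.
    have h : PowerSeries.constantCoeff (((xS - yS) * (xS - yS) + -1 * 1) *
        ((xS + cc m n - yS) * (xS - yS))) =
        (1 - PowerSeries.X ^ 2) * (cS (sdim m n) - PowerSeries.X) * PowerSeries.X := by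
      simp only [map_mul, map_add, map_sub, map_neg, map_one]
      simp only [xS, yS, cc, PowerSeries.constantCoeff_X, PowerSeries.constantCoeff_C]
      ring
    have hc : sdim m n ≠ 0 := sub_ne_zero.mpr (by exact_mod_cast hmn)
    have hu : IsUnit ((1 - PowerSeries.X ^ 2) * (cS (sdim m n) - PowerSeries.X) :
        PowerSeries (Polynomial ℂ)) := by
      rw [PowerSeries.isUnit_iff_constantCoeff]
      simpa [cS] using hc
    rw [h, map_mul, mul_assoc] at hf
    have hf' := (hu.map (scalarHom₁ m n)).mul_right_eq_zero.mp hf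
    rw [scalarHom₁, PowerSeries.map_X] at hf'
    exact PowerSeries.X_mul_cancel (hf'.trans (mul_zero _).symm)

theorem commute_T_of_dualContraction (hmn : m ≠ n) (hU : IsTPlusShift U)
    (hTS : serMat (TPlus m n) * S = 1) (hST : S * serMat (TPlus m n) = 1)
    (hz : superT (serMat U) * superT S = Matrix.diagonal fun _ => z) (N r : ℕ) (i j : Idx m n) :
    Commute (PowerSeries.coeff N z) (evenOp (T m n r) i j) := by
  have hg : ∀ e, gShift m n e =
      (1 - invShift (e - cS (sdim m n)) ^ 2) * gShift m n (e - cS (sdim m n)) := fun e => by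
    rw [← gShift_add hmn, sub_add_cancel]
  have hi : ∀ e, invShift e * (1 + cc m n * invShift (e - cS (sdim m n))) =
      invShift (e - cS (sdim m n)) := fun e => by
    have := invShift_add (e - cS (sdim m n)) (sdim m n)
    rwa [sub_add_cancel] at this
  -- In the mixed relation T⁺ sits in the second leg, whereas the contraction transposes it in the
  -- first. Flipping inverts the R-matrices, which turns the shift by -c into the one required by
  -- crossing symmetry.
  have h := exchange_flip (exchange_mixed (m := m) (n := n))
  have h' := exchange_flip (exchange_mixed_TPlusShift hU)
  have hmap : ∀ {X Y : Matrix (Idx m n) (Idx m n) (PowerSeries (Comp m n))}, X * Y = 1 →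
      X.map inY * Y.map inY = 1 := fun h => by
    rw [← Matrix.map_mul, h, Matrix.map_one _ (map_zero _) (map_one _)]
  rw [← coeff_serMat]
  refine (coeff_commute_of_commute_inX_inY (Eq.symm ?_) r N).symm
  have hga := hg (shiftParam (1 / 2))
  have hgb := hg (shiftParam (-(1 / 2)))
  have ha := hi (shiftParam (1 / 2))
  have hb := hi (shiftParam (-(1 / 2)))
  have hga0 : PowerSeries.constantCoeff (gShift m n (shiftParam (1 / 2))) = 1 :=
    constantCoeff_gShift _
  have hgb0 : PowerSeries.constantCoeff (gShift m n (shiftParam (-(1 / 2)))) = 1 :=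
    constantCoeff_gShift _
  have ha0 : PowerSeries.constantCoeff (invShift (shiftParam (1 / 2))) = 0 :=
    constantCoeff_invShift _
  have hb0 : PowerSeries.constantCoeff (invShift (shiftParam (-(1 / 2)))) = 0 :=
    constantCoeff_invShift _
  have hga0' : PowerSeries.constantCoeff (gShift m n (shiftParam (1 / 2) - cS (sdim m n))) = 1 :=
    constantCoeff_gShift _
  have hgb0' : PowerSeries.constantCoeff (gShift m n (shiftParam (-(1 / 2)) - cS (sdim m n))) = 1 :=
    constantCoeff_gShift _
  have ha0' : PowerSeries.constantCoeff (invShift (shiftParam (1 / 2) - cS (sdim m n))) = 0 :=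
    constantCoeff_invShift _
  have hb0' : PowerSeries.constantCoeff (invShift (shiftParam (-(1 / 2)) - cS (sdim m n))) = 0 :=
    constantCoeff_invShift _
  -- Only the functional equations and the constant terms collected above are needed from here on,
  -- so the series become indeterminates.
  generalize gShift m n (shiftParam (1 / 2)) = γa at *
  generalize gShift m n (shiftParam (-(1 / 2))) = γb at *
  generalize invShift (shiftParam (1 / 2)) = ρa at *
  generalize invShift (shiftParam (-(1 / 2))) = ρb at *
  generalize gShift m n (shiftParam (1 / 2) - cS (sdim m n)) = γa' at *
  generalize gShift m n (shiftParam (-(1 / 2)) - cS (sdim m n)) = γb' at *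
  generalize invShift (shiftParam (1 / 2) - cS (sdim m n)) = ρa' at *
  generalize invShift (shiftParam (-(1 / 2)) - cS (sdim m n)) = ρb' at *
  refine commute_of_exchange (E := CompSeries m n) (κa := 1) (κb := 1) (μa := -ρa)
    (μb := -ρb) h h' (hmap hTS) (hmap hST) (superT_map_mul inY hz) rfl (by ring) rfl (by ring)
    rfl ?_ rfl ?_ ?_ (fun e he => ?_) i j
  · rw [← cc_eq]
    linear_combination -((γb' * γb' - -(ρb' * γb') * -(ρb' * γb')) * γa') * ha
  · rw [← cc_eq]
    linear_combination -((γa' * γa' - -(ρa' * γa') * -(ρa' * γa')) * γb') * hb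
  -- Flipping has introduced the inversion scalar of one side into the other. The functional
  -- equation at both arguments makes these factors agree.
  · rw [hga, hgb]
    ring
  · refine smul_eq_zero_of_constantCoeff (fun f hf => ?_) e he
    simpa [hga0, hgb0, ha0, hb0, hga0', hgb0', ha0', hb0'] using hf

theorem exists_dualQuantumContraction (hmn : m ≠ n) : ∃ z : ℕ → Comp m n,
    IsDualQuantumContraction z ∧ (∀ N, z N ∈ ExtDualYangian m n) ∧ ∀ N w, Commute (z N) w := by
  obtain ⟨S, hTS, hST, hS⟩ := exists_inverse_TPlus (m := m) (n := n)
  obtain ⟨U, hU, hUmem⟩ := exists_isTPlusShift (m := m) (n := n)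
  have h1 : serMat (TPlus m n) * matOfSeries S = 1 := by rw [serMat, ← map_mul, hTS, map_one]
  have h2 : matOfSeries S * serMat (TPlus m n) = 1 := by rw [serMat, ← map_mul, hST, map_one]
  obtain ⟨z, hz⟩ := exists_diagonal_TPlus hmn hU h1 h2
  obtain ⟨i⟩ := nonempty_idx hmn
  refine ⟨fun N => PowerSeries.coeff N z, ⟨U, hU, ?_⟩, fun N => ?_, fun N => ?_⟩
  · refine isContraction_of_superT_mul hTS hST ?_
    have : PowerSeries.mk (fun N => PowerSeries.coeff N z) = z := by ext; simp
    rw [this, ← hz, serMat]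
  · have : z = (superT (serMat U) * superT (matOfSeries S)) i i := by
      rw [hz, Matrix.diagonal_apply_eq]
    beta_reduce
    rw [← mem_extDualSubalgebra, this, Matrix.mul_apply, map_sum]
    refine Subalgebra.sum_mem _ fun k _ => mem_coeff_mul
      (fun N => coeff_superT_mem (fun N i j => ?_) _ _ _)
      (fun N => coeff_superT_mem (fun N i j => ?_) _ _ _) N
    · rw [coeff_serMat, evenOp]
      exact mul_mem (pow_mem (neg_mem (one_mem _)) _) (hUmem N i j)
    · rw [coeff_matOfSeries]
      exact hS N i j
  · exact commute_of_commute_T_TPlus (commute_T_of_dualContraction hmn hU h1 h2 hz N)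
      (commute_TPlus_of_dualContraction hmn hU h1 h2 hz N)

/-- Limits in the completion are unique, so the shifted series U is determined; then uniqueness for
a fixed U applies. -/
theorem IsDualQuantumContraction.unique (hmn : m ≠ n) {z w : ℕ → Comp m n}
    (hz : IsDualQuantumContraction z) (hw : IsDualQuantumContraction w) : w = z := by
  obtain ⟨U, hU, hz⟩ := hz
  obtain ⟨U', hU', hw⟩ := hw
  obtain rfl : U' = U := by
    funext N i j
    exact (hU' N i j).unique (hU N i j)
  exact hz.unique hmn hw

theorem mem_extDY_of_mem_yangian {x : Comp m n} (hx : x ∈ Yangian m n) : x ∈ ExtDY m n :=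
  Algebra.subset_adjoin (Submodule.subset_span
    ⟨0, 1, (extDualSubalgebra m n).one_mem, x, hx, by rw [pow_zero, one_mul, one_mul]⟩)

theorem mem_extDY_of_mem_extDualYangian {x : Comp m n} (hx : x ∈ ExtDualYangian m n) :
    x ∈ ExtDY m n :=
  Algebra.subset_adjoin (Submodule.subset_span
    ⟨0, x, hx, 1, one_mem _, by rw [pow_zero, one_mul, mul_one]⟩)

theorem mem_center_extDY {x : ExtDY m n} (h : ∀ w : Comp m n, Commute (x : Comp m n) w) :
    x ∈ Subalgebra.center ℂ (ExtDY m n) :=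
  Subalgebra.mem_center_iff.mpr fun w => Subtype.ext (h w).symm

end DualQuantumContraction

end DoubleYangian
end
theorem mainTheorem4 (m n : ℕ) (hmn : m ≠ n) :
    (∃ z : ℕ → DoubleYangian.ExtDY m n,
      DoubleYangian.IsQuantumContraction (fun N => (z N : DoubleYangian.Comp m n)) ∧
      (∀ w : ℕ → DoubleYangian.Comp m n, DoubleYangian.IsQuantumContraction w →
        w = fun N => (z N : DoubleYangian.Comp m n)) ∧
      (∀ N, (z N : DoubleYangian.Comp m n) ∈ DoubleYangian.Yangian m n) ∧
      ∀ N, z N ∈ Subalgebra.center ℂ (DoubleYangian.ExtDY m n)) ∧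
    (∃ z : ℕ → DoubleYangian.ExtDY m n,
      DoubleYangian.IsDualQuantumContraction (fun N => (z N : DoubleYangian.Comp m n)) ∧
      (∀ w : ℕ → DoubleYangian.Comp m n, DoubleYangian.IsDualQuantumContraction w →
        w = fun N => (z N : DoubleYangian.Comp m n)) ∧
      (∀ N, (z N : DoubleYangian.Comp m n) ∈ DoubleYangian.ExtDualYangian m n) ∧
      ∀ N, z N ∈ Subalgebra.center ℂ (DoubleYangian.ExtDY m n)) := by
  open DoubleYangian in
  constructor
  · obtain ⟨z, hz, hY, hc⟩ := exists_quantumContraction hmn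
    exact ⟨fun N => ⟨z N, mem_extDY_of_mem_yangian (hY N)⟩, hz, fun w hw => hz.unique hmn hw, hY,
      fun N => mem_center_extDY (hc N)⟩
  · obtain ⟨z, hz, hY, hc⟩ := exists_dualQuantumContraction hmn
    exact ⟨fun N => ⟨z N, mem_extDY_of_mem_extDualYangian (hY N)⟩, hz, fun w hw => hz.unique hmn hw,
      hY, fun N => mem_center_extDY (hc N)⟩
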